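/- **Theorem 2.1 (Comparison Principle).** Let $N\ge 1$, let $\Omega\subset\mathbb{R}^N$ be open and bounded, and let $1<p<N$. Let $G_1,G_2:\Omega\times(0,\infty)\to[0,\infty)$ be Carathéodory functions (measurable in $x$ for every $s$, continuous in $s$ for almost every $x$) such that $$G_1(x,s)\le G_2(x,s)\qquad\text{for a.e. }x\in\Omega\text{ and all }s\in(0,\infty),$$ and such that, for at least one $i\in\{1,2\}$, the function $s\mapsto G_i(x,s)\,s^{1-p}$ is strictly decreasing on $(0,\infty)$ for almost every $x\in\Omega$. For $i=1,2$ let $v_i$ be a weak solution of $$-\Delta_p v_i=G_i(x,v_i)\ \text{ in }\Omega,\qquad v_i>0\ \text{ in }\Omega,\qquad v_i=0\ \text{ on }\partial\Omega,$$ that is, $v_i\in W^{1,p}_0(\Omega)$ (the closure of $C^\infty_c(\Omega)$ in $W^{1,p}(\Omega)$), $v_i>0$ a.e. in $\Omega$, $G_i(\cdot,v_i)\in L^1_{\mathrm{loc}}(\Omega)$, and $$\int_\Omega|\nabla v_i|^{p-2}\nabla v_i\cdot\nabla\varphi\,dx=\int_\Omega G_i(x,v_i)\,\varphi\,dx\qquad\text{for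 all }\varphi\in C^1_c(\Omega).$$ (The solutions are not assumed to be bounded.) Then $v_1\le v_2$ almost everywhere in $\Omega$. -/

import Mathlib

open MeasureTheory Filter Set
open scoped Topology ContDiff Gradient

/-- `φ ∈ C^k_c(Ω)`: a real function of class `C^k` on `ℝ^N` whose (compact) support lies in `Ω`. -/
structure IsTestFunction {N : ℕ} (k : WithTop ℕ∞) (Ω : Set (EuclideanSpace ℝ (Fin N)))
    (φ : EuclideanSpace ℝ (Fin N) → ℝ) : Prop where
  contDiff : ContDiff ℝ k φ
  hasCompactSupport : HasCompactSupport φ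
  tsupport_subset : tsupport φ ⊆ Ω

/-- `Du` is a weak (distributional) gradient of `u` on the open set `Ω`. The integration by parts
formula is written for all components at once, as an identity between vectors of `ℝ^N`. -/
structure IsWeakGradient {N : ℕ} (Ω : Set (EuclideanSpace ℝ (Fin N)))
    (u : EuclideanSpace ℝ (Fin N) → ℝ)
    (Du : EuclideanSpace ℝ (Fin N) → EuclideanSpace ℝ (Fin N)) : Prop where
  locallyIntegrableOn : LocallyIntegrableOn u Ω
  locallyIntegrableOn_grad : LocallyIntegrableOn Du Ω
  integral_eq : ∀ φ : EuclideanSpace ℝ (Fin N) → ℝ, IsTestFunction ∞ Ω φ →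
    ∫ x in Ω, u x • ∇ φ x = -∫ x in Ω, φ x • Du x

/-- `u ∈ W^{1,p}(Ω)` with weak gradient `Du`. -/
structure MemSobolev {N : ℕ} (p : ℝ) (Ω : Set (EuclideanSpace ℝ (Fin N)))
    (u : EuclideanSpace ℝ (Fin N) → ℝ)
    (Du : EuclideanSpace ℝ (Fin N) → EuclideanSpace ℝ (Fin N)) : Prop where
  isWeakGradient : IsWeakGradient Ω u Du
  memLp : MemLp u (ENNReal.ofReal p) (volume.restrict Ω)
  memLp_grad : MemLp Du (ENNReal.ofReal p) (volume.restrict Ω)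

/-- `u ∈ W^{1,p}_0(Ω)` with weak gradient `Du`: `u` belongs to the closure of `C^∞_c(Ω)` in
`W^{1,p}(Ω)`. -/
structure MemSobolevZero {N : ℕ} (p : ℝ) (Ω : Set (EuclideanSpace ℝ (Fin N)))
    (u : EuclideanSpace ℝ (Fin N) → ℝ)
    (Du : EuclideanSpace ℝ (Fin N) → EuclideanSpace ℝ (Fin N)) : Prop
    extends MemSobolev p Ω u Du where
  exists_approx : ∃ φ : ℕ → EuclideanSpace ℝ (Fin N) → ℝ,
    (∀ n, IsTestFunction ∞ Ω (φ n)) ∧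
    Tendsto (fun n => eLpNorm (fun x => φ n x - u x) (ENNReal.ofReal p) (volume.restrict Ω))
      atTop (𝓝 0) ∧
    Tendsto (fun n => eLpNorm (fun x => ∇ (φ n) x - Du x) (ENNReal.ofReal p) (volume.restrict Ω))
      atTop (𝓝 0)

/-- `G : Ω × (0,∞) → ℝ` is a Carathéodory function: Lebesgue measurable in `x ∈ Ω` for every
`s > 0`, and continuous in `s ∈ (0,∞)` for almost every `x ∈ Ω`. The values of `G` outside
`Ω × (0,∞)` play no role. -/
structure IsCaratheodory {N : ℕ} (Ω : Set (EuclideanSpace ℝ (Fin N)))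
    (G : EuclideanSpace ℝ (Fin N) → ℝ → ℝ) : Prop where
  aemeasurable : ∀ s : ℝ, 0 < s → AEMeasurable (fun x => G x s) (volume.restrict Ω)
  continuousOn : ∀ᵐ x ∂(volume.restrict Ω), ContinuousOn (G x) (Ioi 0)

/-- `u` is a (positive, finite energy) weak solution of `-Δ_p u = G(x,u)` in `Ω`, `u > 0` in `Ω`,
`u = 0` on `∂Ω`. The weak gradient `Du` of `u` is unique up to null sets. For `Du x = 0` the
vector `‖Du x‖ ^ (p - 2) • Du x` is `0`, as usual. -/
def IsWeakSolution {N : ℕ} (p : ℝ) (Ω : Set (EuclideanSpace ℝ (Fin N)))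
    (G : EuclideanSpace ℝ (Fin N) → ℝ → ℝ) (u : EuclideanSpace ℝ (Fin N) → ℝ) : Prop :=
  ∃ Du : EuclideanSpace ℝ (Fin N) → EuclideanSpace ℝ (Fin N),
    MemSobolevZero p Ω u Du ∧
    (∀ᵐ x ∂(volume.restrict Ω), 0 < u x) ∧
    LocallyIntegrableOn (fun x => G x (u x)) Ω ∧
    ∀ φ : EuclideanSpace ℝ (Fin N) → ℝ, IsTestFunction 1 Ω φ →
      ∫ x in Ω, inner ℝ (‖Du x‖ ^ (p - 2) • Du x) (∇ φ x) = ∫ x in Ω, G x (u x) * φ x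

/-!
Put `V_i = v_i + ε` and `w = (1 - V₂/V₁)^+`, a function supported on `{v₁ > v₂}`. With
`τ = (k V₁ / (k + V₁))^p`, a bounded substitute for `V₁^p`, the equation of `v₁` is tested with
`τ w² V₁^{1-p}` and that of `v₂` with `τ w² V₂^{1-p}` (`profileFst`, `profileSnd`). Formally, for
`ε = 0` and `k = ∞`, the difference of the two right hand sides is
`∫ (G₁(x,v₁) v₁^{1-p} - G₂(x,v₂) v₂^{1-p}) v₁^p w²`, whose integrand is strictly negative on
`{v₁ > v₂}` by the monotonicity hypothesis and `G₁ ≤ G₂`. The difference of the two left hand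
sides is nonnegative: in terms of the logarithmic gradients `X`, `Y` of `V₁`, `V₂` its integrand is
a sum of two nonnegative terms, one by monotonicity of the flux and one by convexity of `|·|^p`
(`picone_normalized`). So `{v₁ > v₂}` is a null set.

The truncation costs at most `(p - 1) ∫ V₁ / (k + V₁) |∇v₁|^p` (`picone_profile`), which tends to
`0` because `v₁` has finite energy. No boundedness of `v₁`, and no positive lower bound for `v₂`, is
needed. On the right hand side the test function of `v₁` is dominated by its own limit
(`profileFst_le`), whose integral against `G₁(x,v₁)` is finite since the gradient of the profile is
bounded uniformly in `k` and `ε`; Fatou's lemma handles the equation of `v₂`.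

That such functions of `(v₁, v₂)` may be used as test functions, although `G_i(x,v_i)` is only
locally integrable, is `lintegral_ofReal_mul_profile`. Since both solutions are limits of smooth
functions of compact support, it is enough to insert the approximations into the `C^1` profiles, so
no chain rule for weak derivatives is used.
-/

/-! ### The flux of the `p`-Laplacian -/

/-- The vector field `ξ ↦ |ξ|^{p-2} ξ`, written exactly as in `IsWeakSolution`. -/
noncomputable def pFlux {E : Type*} [NormedAddCommGroup E] [NormedSpace ℝ E] (p : ℝ) (ξ : E) : E :=
  ‖ξ‖ ^ (p - 2) • ξ

section Flux

variable {E : Type*} [NormedAddCommGroup E] [InnerProductSpace ℝ E] {p : ℝ}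

lemma norm_pFlux (hp : 1 < p) (ξ : E) : ‖pFlux p ξ‖ = ‖ξ‖ ^ (p - 1) := by
  rcases eq_or_ne ξ 0 with rfl | h
  · simp [pFlux, Real.zero_rpow (by linarith : p - 1 ≠ 0)]
  · have h' : 0 < ‖ξ‖ := norm_pos_iff.2 h
    rw [pFlux, norm_smul, Real.norm_of_nonneg (Real.rpow_nonneg h'.le _),
      ← Real.rpow_add_one h'.ne']
    congr 1; ring

lemma inner_pFlux_self (hp : 1 < p) (ξ : E) : inner ℝ (pFlux p ξ) ξ = ‖ξ‖ ^ p := by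
  rcases eq_or_ne ξ 0 with rfl | h
  · simp [Real.zero_rpow (by linarith : p ≠ 0)]
  · have h' : 0 < ‖ξ‖ := norm_pos_iff.2 h
    rw [pFlux, inner_smul_left, real_inner_self_eq_norm_sq, ← Real.rpow_natCast,
      RCLike.conj_to_real, ← Real.rpow_add h']
    congr 1; push_cast; ring

lemma pFlux_smul {c : ℝ} (hc : 0 < c) (ξ : E) :
    pFlux p (c • ξ) = c ^ (p - 1) • pFlux p ξ := by
  rw [pFlux, pFlux, norm_smul, Real.norm_of_nonneg hc.le,
    Real.mul_rpow hc.le (norm_nonneg _), smul_smul, smul_smul]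
  congr 1
  have : c ^ (p - 1) = c ^ (p - 2) * c := by
    rw [← Real.rpow_add_one hc.ne']; congr 1; ring
  rw [this]; ring

/-- Young's inequality for the pairing of the flux with a vector. -/
lemma abs_inner_pFlux_le (hp : 1 < p) (ξ η : E) :
    |inner ℝ (pFlux p ξ) η| ≤ (1 - 1 / p) * ‖ξ‖ ^ p + 1 / p * ‖η‖ ^ p := by
  have hc := Real.HolderConjugate.conjExponent hp
  have h1 := Real.young_inequality_of_nonneg (norm_nonneg η)
    (Real.rpow_nonneg (norm_nonneg ξ) (p - 1)) hc
  have h2 := abs_real_inner_le_norm (pFlux p ξ) η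
  rw [norm_pFlux hp] at h2
  rw [← Real.rpow_mul (norm_nonneg ξ), mul_comm (p - 1), Real.conjExponent,
    div_mul_cancel₀ _ (by linarith : p - 1 ≠ 0)] at h1
  have h3 : ‖ξ‖ ^ p / (p / (p - 1)) = (1 - 1 / p) * ‖ξ‖ ^ p := by
    have : p ≠ 0 := by linarith
    field_simp
  rw [h3] at h1
  calc _ ≤ _ := h2
    _ = ‖η‖ * ‖ξ‖ ^ (p - 1) := mul_comm _ _
    _ ≤ _ := h1
    _ = _ := by ring

/-- The normalised form of the Picone-type inequality behind the comparison principle: `X` and `Y`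
stand for the logarithmic gradients of the two solutions. For `κ = 1` the right hand side vanishes;
the factor `κ < 1` is the price of truncating large values of the first solution. -/
lemma picone_normalized (hp : 1 < p) {w κ : ℝ} (hw0 : 0 ≤ w) (hw1 : w ≤ 1) (hκ0 : 0 ≤ κ)
    (hκ1 : κ ≤ 1) (X Y : E) :
    -((p - 1) * (1 - κ) * ‖X‖ ^ p) ≤
      ((p * κ * w ^ 2 + 2 * w * (1 - w) + (1 - p) * w ^ 2) * ‖X‖ ^ p
          - 2 * w * (1 - w) * inner ℝ (pFlux p X) Y)
        - ((p * κ * w ^ 2 + 2 * w * (1 - w)) * inner ℝ (pFlux p Y) X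
          + (-(2 * w * (1 - w)) + (1 - p) * w ^ 2) * ‖Y‖ ^ p) := by
  have hXY := (abs_le.1 (abs_inner_pFlux_le hp X Y)).2
  have hYX := (abs_le.1 (abs_inner_pFlux_le hp Y X)).2
  have hX : 0 ≤ ‖X‖ ^ p := Real.rpow_nonneg (norm_nonneg _) _
  have hY : 0 ≤ ‖Y‖ ^ p := Real.rpow_nonneg (norm_nonneg _) _
  generalize inner ℝ (pFlux p X) Y = a at *
  generalize inner ℝ (pFlux p Y) X = b at *
  generalize ‖X‖ ^ p = x at *
  generalize ‖Y‖ ^ p = y at *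
  -- monotonicity of the flux
  have h1 : 0 ≤ 2 * w * (1 - w) * (x + y - a - b) :=
    mul_nonneg (mul_nonneg (by linarith) (by linarith)) (by linarith)
  -- convexity of `ξ ↦ |ξ|^p`
  have h2 : p * b ≤ (p - 1) * y + x := by
    have := mul_le_mul_of_nonneg_left hYX (by linarith : 0 ≤ p)
    have hp0 : p ≠ 0 := by linarith
    calc p * b ≤ _ := this
      _ = _ := by field_simp
  have h3 : 0 ≤ w ^ 2 * κ * ((p - 1) * y + x - p * b) :=
    mul_nonneg (by positivity) (by linarith)
  have h4 : 0 ≤ w ^ 2 * ((p - 1) * (1 - κ) * y) :=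
    mul_nonneg (by positivity) (mul_nonneg (mul_nonneg (by linarith) (by linarith)) hY)
  have h5 : 0 ≤ (1 - w ^ 2) * ((p - 1) * (1 - κ) * x) :=
    mul_nonneg (by nlinarith) (mul_nonneg (mul_nonneg (by linarith) (by linarith)) hX)
  linarith

end Flux

lemma MeasureTheory.MemLp.pFlux {α E : Type*} {m : MeasurableSpace α} {μ : Measure α}
    [NormedAddCommGroup E] [InnerProductSpace ℝ E] {p : ℝ} (hp : 1 < p) {D : α → E}
    (hD : MemLp D (ENNReal.ofReal p) μ) :
    MemLp (fun x => pFlux p (D x)) (ENNReal.ofReal (Real.conjExponent p)) μ := by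
  have h1 : MemLp (fun x => ‖D x‖ ^ (p - 1)) (ENNReal.ofReal (Real.conjExponent p)) μ := by
    have := hD.norm_rpow_div (ENNReal.ofReal (p - 1))
    rwa [ENNReal.toReal_ofReal (by linarith), ← ENNReal.ofReal_div_of_pos (by linarith)] at this
  refine h1.congr_norm ?_ (Eventually.of_forall fun x => ?_)
  · exact (hD.1.norm.aemeasurable.pow_const _).aestronglyMeasurable.smul hD.1
  · rw [norm_pFlux hp, Real.norm_of_nonneg (Real.rpow_nonneg (norm_nonneg _) _)]

/-! ### The test function profiles -/

/-- A positive `C^1` function on the line that equals `s + ε` for `s ≥ 0`. Only its values on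
`[0, ∞)` matter in the end; the extension lets one insert smooth approximations of a nonnegative
function, which may take negative values. -/
noncomputable def posShift (ε s : ℝ) : ℝ :=
  if 0 ≤ s then s + ε else ε * (1 + Real.exp (2 * s / ε)) / 2

section PosShift

variable {ε : ℝ}

lemma posShift_of_nonneg {s : ℝ} (hs : 0 ≤ s) : posShift ε s = s + ε := if_pos hs

lemma half_le_posShift (hε : 0 < ε) (s : ℝ) : ε / 2 ≤ posShift ε s := by
  unfold posShift
  split_ifs
  · linarith
  · nlinarith [Real.exp_pos (2 * s / ε)]

lemma posShift_pos (hε : 0 < ε) (s : ℝ) : 0 < posShift ε s :=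
  lt_of_lt_of_le (by positivity) (half_le_posShift hε s)

lemma hasDerivAt_posShift (hε : 0 < ε) (s : ℝ) :
    HasDerivAt (posShift ε) (Real.exp (min (2 * s / ε) 0)) s := by
  have hr (s : ℝ) : HasDerivAt (fun s : ℝ => s + ε) 1 s := (hasDerivAt_id s).add_const ε
  have hl (s : ℝ) : HasDerivAt (fun s : ℝ => ε * (1 + Real.exp (2 * s / ε)) / 2)
      (Real.exp (2 * s / ε)) s := by
    have h := (((((hasDerivAt_id s).const_mul 2).div_const ε).exp.const_add 1).const_mul
      ε).div_const 2
    refine h.congr_deriv ?_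
    simp only [id]
    field_simp
  rcases lt_trichotomy s 0 with h | rfl | h
  · have : 2 * s / ε ≤ 0 := div_nonpos_of_nonpos_of_nonneg (by linarith) hε.le
    rw [min_eq_left this]
    refine (hl s).congr_of_eventuallyEq ?_
    filter_upwards [gt_mem_nhds h] with t ht
    exact if_neg (not_le.2 ht)
  · have h1 : HasDerivWithinAt (posShift ε) 1 (Iic 0) 0 := by
      have := (hl 0).hasDerivWithinAt (s := Iic 0)
      simp only [mul_zero, zero_div, Real.exp_zero] at this
      refine this.congr (fun t ht => ?_) ?_
      · rcases (mem_Iic.1 ht).lt_or_eq with h | rfl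
        · exact if_neg (not_le.2 h)
        · simp [posShift]; ring
      · simp [posShift]; ring
    have h2 : HasDerivWithinAt (posShift ε) 1 (Ici 0) 0 :=
      (hr 0).hasDerivWithinAt.congr (fun t ht => if_pos ht) (if_pos le_rfl)
    simpa [Iic_union_Ici] using h1.union h2
  · have : 0 ≤ 2 * s / ε := by positivity
    rw [min_eq_right this, Real.exp_zero]
    refine (hr s).congr_of_eventuallyEq ?_
    filter_upwards [lt_mem_nhds h] with t ht
    exact if_pos (le_of_lt ht)

lemma contDiff_posShift (hε : 0 < ε) : ContDiff ℝ 1 (posShift ε) := by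
  refine contDiff_one_iff_deriv.2 ⟨fun s => (hasDerivAt_posShift hε s).differentiableAt, ?_⟩
  rw [show deriv (posShift ε) = fun s => Real.exp (min (2 * s / ε) 0) from
    funext fun s => (hasDerivAt_posShift hε s).deriv]
  fun_prop

end PosShift

lemma hasDerivAt_max_zero_sq (s : ℝ) :
    HasDerivAt (fun s : ℝ => max s 0 ^ 2) (2 * max s 0) s := by
  rcases lt_trichotomy s 0 with h | rfl | h
  · rw [max_eq_right h.le, mul_zero]
    refine (hasDerivAt_const s (0 : ℝ)).congr_of_eventuallyEq ?_
    filter_upwards [gt_mem_nhds h] with t ht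
    simp [max_eq_right (le_of_lt ht)]
  · rw [hasDerivAt_iff_isLittleO_nhds_zero]
    have h1 : (fun h : ℝ => h ^ 2) =o[𝓝 0] fun h : ℝ => h := by
      simpa using Asymptotics.isLittleO_pow_pow (𝕜 := ℝ) (m := 1) (n := 2) (by norm_num)
    refine Asymptotics.IsBigO.trans_isLittleO (Asymptotics.IsBigO.of_norm_le fun h => ?_) h1
    have : |max h 0| ≤ |h| := by
      rw [abs_of_nonneg (le_max_right _ _)]; exact max_le (le_abs_self h) (abs_nonneg h)
    simpa using sq_le_sq.2 this
  · rw [max_eq_left h.le]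
    refine ((hasDerivAt_pow 2 s).congr_of_eventuallyEq ?_).congr_deriv (by simp)
    filter_upwards [lt_mem_nhds h] with t ht
    simp [max_eq_left (le_of_lt ht)]

lemma contDiff_max_zero_sq : ContDiff ℝ 1 (fun s : ℝ => max s 0 ^ 2) := by
  refine contDiff_one_iff_deriv.2 ⟨fun s => (hasDerivAt_max_zero_sq s).differentiableAt, ?_⟩
  rw [show deriv (fun s : ℝ => max s 0 ^ 2) = fun s => 2 * max s 0 from
    funext fun s => (hasDerivAt_max_zero_sq s).deriv]
  fun_prop

/-- The relative excess `(1 - y/x)^+` of `x` over `y`. -/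
noncomputable def relExcess (x y : ℝ) : ℝ := max (1 - y / x) 0

/-- The truncated power `(k x / (k + x))^p`: it is at most `min(x, k)^p` and increases to `x^p` as
`k → ∞`. -/
noncomputable def truncPow (p k x : ℝ) : ℝ := (k * x / (k + x)) ^ p

section Profile

variable {p k x y : ℝ}

lemma relExcess_nonneg : 0 ≤ relExcess x y := le_max_right _ _

lemma relExcess_le_one (hx : 0 < x) (hy : 0 < y) : relExcess x y ≤ 1 :=
  max_le (by linarith [div_pos hy hx]) zero_le_one

lemma relExcess_mul_div :
    relExcess x y * (y / x) = relExcess x y * (1 - relExcess x y) := by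
  unfold relExcess
  rcases le_total (1 - y / x) 0 with h | h
  · simp [max_eq_right h]
  · rw [max_eq_left h]; ring

lemma truncPow_pos (hk : 0 < k) (hx : 0 < x) : 0 < truncPow p k x :=
  Real.rpow_pos_of_pos (by positivity) _

lemma truncPow_le_rpow (hp : 0 ≤ p) (hk : 0 < k) (hx : 0 < x) : truncPow p k x ≤ x ^ p := by
  refine Real.rpow_le_rpow (by positivity) ?_ hp
  rw [div_le_iff₀ (by positivity)]
  nlinarith

lemma truncPow_le_const (hp : 0 ≤ p) (hk : 0 < k) (hx : 0 < x) : truncPow p k x ≤ k ^ p := by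
  refine Real.rpow_le_rpow (by positivity) ?_ hp
  rw [div_le_iff₀ (by positivity)]
  nlinarith

lemma hasDerivAt_truncPow (hk : 0 < k) (hx : 0 < x) :
    HasDerivAt (truncPow p k) (truncPow p k x / x * (p * (k / (k + x)))) x := by
  have hkx : k + x ≠ 0 := by positivity
  have h1 : HasDerivAt (fun x : ℝ => k * x / (k + x)) ((k * (k + x) - k * x) / (k + x) ^ 2) x := by
    have := ((hasDerivAt_id x).const_mul k).div ((hasDerivAt_id x).const_add k) hkx
    exact this.congr_deriv (by simp)
  have h2 := h1.rpow_const (p := p) (Or.inl (by positivity))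
  refine h2.congr_deriv ?_
  rw [truncPow, Real.rpow_sub_one (by positivity)]
  field_simp
  ring

lemma hasDerivAt_relExcess_sq_left (hx : 0 < x) :
    HasDerivAt (fun x => relExcess x y ^ 2)
      (2 * relExcess x y * (1 - relExcess x y) / x) x := by
  have h1 : HasDerivAt (fun x : ℝ => 1 - y / x) (y / x ^ 2) x := by
    have := ((hasDerivAt_inv hx.ne').const_mul y).const_sub 1
    refine (this.congr_deriv ?_)
    field_simp
  refine ((hasDerivAt_max_zero_sq _).comp x h1).congr_deriv ?_
  change 2 * relExcess x y * (y / x ^ 2) = _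
  rw [mul_assoc 2 (relExcess x y) (1 - _), ← relExcess_mul_div]
  field_simp

lemma hasDerivAt_relExcess_sq_right :
    HasDerivAt (fun y => relExcess x y ^ 2) (-(2 * relExcess x y / x)) y := by
  have h1 : HasDerivAt (fun y : ℝ => 1 - y / x) (-(1 / x)) y :=
    ((hasDerivAt_id y).div_const x).const_sub 1
  refine ((hasDerivAt_max_zero_sq _).comp y h1).congr_deriv ?_
  change 2 * relExcess x y * _ = _
  ring

lemma hasDerivAt_rpow_one_sub (hx : 0 < x) :
    HasDerivAt (fun x : ℝ => x ^ (1 - p)) ((1 - p) * x ^ (-p)) x := by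
  have := Real.hasDerivAt_rpow_const (p := 1 - p) (Or.inl hx.ne')
  rwa [show 1 - p - 1 = -p by ring] at this

end Profile

/-- The truncated, shifted version of `((v₁ - v₂)^+)² v₁^{p-2} / v₁^{p-1}`, the test function for
the equation of `v₁`, as a function of `z = (v₁, v₂)`. -/
noncomputable def profileFst (p k ε : ℝ) (z : ℝ × ℝ) : ℝ :=
  truncPow p k (posShift ε z.1) * relExcess (posShift ε z.1) (posShift ε z.2) ^ 2 *
    posShift ε z.1 ^ (1 - p)

/-- The truncated, shifted version of `((v₁ - v₂)^+)² v₁^{p-2} / v₂^{p-1}`, the test function for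
the equation of `v₂`, as a function of `z = (v₁, v₂)`. -/
noncomputable def profileSnd (p k ε : ℝ) (z : ℝ × ℝ) : ℝ :=
  truncPow p k (posShift ε z.1) * relExcess (posShift ε z.1) (posShift ε z.2) ^ 2 *
    posShift ε z.2 ^ (1 - p)

section Profiles

variable {p k ε : ℝ}

lemma contDiff_truncPow_posShift_fst (hk : 0 < k) (hε : 0 < ε) :
    ContDiff ℝ 1 fun z : ℝ × ℝ => truncPow p k (posShift ε z.1) := by
  have h := (contDiff_posShift hε).comp (contDiff_fst (𝕜 := ℝ) (E := ℝ) (F := ℝ))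
  have hpos (z : ℝ × ℝ) : 0 < posShift ε z.1 := posShift_pos hε _
  exact ((contDiff_const.mul h).div (contDiff_const.add h)
    fun z => (add_pos hk (hpos z)).ne').rpow_const_of_ne
      fun z => (div_pos (mul_pos hk (hpos z)) (add_pos hk (hpos z))).ne'

lemma contDiff_relExcess_posShift (hε : 0 < ε) :
    ContDiff ℝ 1 fun z : ℝ × ℝ => relExcess (posShift ε z.1) (posShift ε z.2) ^ 2 := by
  have h1 := (contDiff_posShift hε).comp (contDiff_fst (𝕜 := ℝ) (E := ℝ) (F := ℝ))
  have h2 := (contDiff_posShift hε).comp (contDiff_snd (𝕜 := ℝ) (E := ℝ) (F := ℝ))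
  exact contDiff_max_zero_sq.comp
    (contDiff_const.sub (h2.div h1 fun z => (posShift_pos hε z.1).ne'))

lemma contDiff_profileFst (hk : 0 < k) (hε : 0 < ε) : ContDiff ℝ 1 (profileFst p k ε) :=
  ((contDiff_truncPow_posShift_fst hk hε).mul (contDiff_relExcess_posShift hε)).mul
    (((contDiff_posShift hε).comp contDiff_fst).rpow_const_of_ne
      fun z => (posShift_pos hε z.1).ne')

lemma contDiff_profileSnd (hk : 0 < k) (hε : 0 < ε) : ContDiff ℝ 1 (profileSnd p k ε) :=
  ((contDiff_truncPow_posShift_fst hk hε).mul (contDiff_relExcess_posShift hε)).mul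
    (((contDiff_posShift hε).comp contDiff_snd).rpow_const_of_ne
      fun z => (posShift_pos hε z.2).ne')

lemma fderiv_apply_one_zero {F : ℝ × ℝ → ℝ} (hF : ContDiff ℝ 1 F) {z : ℝ × ℝ} {a : ℝ}
    (h : HasDerivAt (fun s => F (s, z.2)) a z.1) : fderiv ℝ F z (1, 0) = a := by
  have h1 : HasFDerivAt F (fderiv ℝ F z) (z.1, z.2) :=
    (hF.differentiable one_ne_zero z).hasFDerivAt
  exact (h1.comp_hasDerivAt z.1 ((hasDerivAt_id z.1).prodMk (hasDerivAt_const z.1 z.2))).unique h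

lemma fderiv_apply_zero_one {F : ℝ × ℝ → ℝ} (hF : ContDiff ℝ 1 F) {z : ℝ × ℝ} {a : ℝ}
    (h : HasDerivAt (fun t => F (z.1, t)) a z.2) : fderiv ℝ F z (0, 1) = a := by
  have h1 : HasFDerivAt F (fderiv ℝ F z) (z.1, z.2) :=
    (hF.differentiable one_ne_zero z).hasFDerivAt
  exact (h1.comp_hasDerivAt z.2 ((hasDerivAt_const z.2 z.1).prodMk (hasDerivAt_id z.2))).unique h

section Partials

variable {x y w e₁ e₂ : ℝ}

lemma fderiv_profileFst_fst (hk : 0 < k) (hε : 0 < ε) (z : ℝ × ℝ)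
    (hx : posShift ε z.1 = x) (hy : posShift ε z.2 = y) (hw : relExcess x y = w)
    (he₁ : Real.exp (min (2 * z.1 / ε) 0) = e₁) :
    fderiv ℝ (profileFst p k ε) z (1, 0) =
      truncPow p k x * x ^ (-p) *
        (p * (k / (k + x)) * w ^ 2 + 2 * w * (1 - w) + (1 - p) * w ^ 2) * e₁ := by
  refine fderiv_apply_one_zero (contDiff_profileFst hk hε) ?_
  subst hx hy hw he₁
  have hx := posShift_pos hε z.1
  have h := ((hasDerivAt_truncPow (p := p) hk hx).mul
    (hasDerivAt_relExcess_sq_left (y := posShift ε z.2) hx)).mul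
    (hasDerivAt_rpow_one_sub (p := p) hx)
  refine (h.comp z.1 (hasDerivAt_posShift hε z.1)).congr_deriv ?_
  have : posShift ε z.1 ^ (1 - p) = posShift ε z.1 ^ (-p) * posShift ε z.1 := by
    rw [← Real.rpow_add_one hx.ne']; congr 1; ring
  simp only [Pi.mul_apply]
  rw [this]
  field_simp

lemma fderiv_profileFst_snd (hk : 0 < k) (hε : 0 < ε) (z : ℝ × ℝ)
    (hx : posShift ε z.1 = x) (hy : posShift ε z.2 = y) (hw : relExcess x y = w)
    (he₂ : Real.exp (min (2 * z.2 / ε) 0) = e₂) :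
    fderiv ℝ (profileFst p k ε) z (0, 1) = -(truncPow p k x * x ^ (-p) * (2 * w)) * e₂ := by
  refine fderiv_apply_zero_one (contDiff_profileFst hk hε) ?_
  subst hx hy hw he₂
  have hx := posShift_pos hε z.1
  have h := ((hasDerivAt_relExcess_sq_right (x := posShift ε z.1)
    (y := posShift ε z.2)).const_mul (truncPow p k (posShift ε z.1))).mul_const
    (posShift ε z.1 ^ (1 - p))
  refine (h.comp z.2 (hasDerivAt_posShift hε z.2)).congr_deriv ?_
  have : posShift ε z.1 ^ (1 - p) = posShift ε z.1 ^ (-p) * posShift ε z.1 := by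
    rw [← Real.rpow_add_one hx.ne']; congr 1; ring
  rw [this]
  field_simp

lemma fderiv_profileSnd_fst (hk : 0 < k) (hε : 0 < ε) (z : ℝ × ℝ)
    (hx : posShift ε z.1 = x) (hy : posShift ε z.2 = y) (hw : relExcess x y = w)
    (he₁ : Real.exp (min (2 * z.1 / ε) 0) = e₁) :
    fderiv ℝ (profileSnd p k ε) z (1, 0) =
      truncPow p k x * y ^ (1 - p) / x *
        (p * (k / (k + x)) * w ^ 2 + 2 * w * (1 - w)) * e₁ := by
  refine fderiv_apply_one_zero (contDiff_profileSnd hk hε) ?_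
  subst hx hy hw he₁
  have hx := posShift_pos hε z.1
  have h := ((hasDerivAt_truncPow (p := p) hk hx).mul
    (hasDerivAt_relExcess_sq_left (y := posShift ε z.2) hx)).mul_const
    (posShift ε z.2 ^ (1 - p))
  refine (h.comp z.1 (hasDerivAt_posShift hε z.1)).congr_deriv ?_
  field_simp

lemma fderiv_profileSnd_snd (hk : 0 < k) (hε : 0 < ε) (z : ℝ × ℝ)
    (hx : posShift ε z.1 = x) (hy : posShift ε z.2 = y) (hw : relExcess x y = w)
    (he₂ : Real.exp (min (2 * z.2 / ε) 0) = e₂) :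
    fderiv ℝ (profileSnd p k ε) z (0, 1) =
      truncPow p k x * y ^ (-p) * (-(2 * w * (1 - w)) + (1 - p) * w ^ 2) * e₂ := by
  refine fderiv_apply_zero_one (contDiff_profileSnd hk hε) ?_
  subst hx hy hw he₂
  have hx := posShift_pos hε z.1
  have hy := posShift_pos hε z.2
  have h := ((hasDerivAt_relExcess_sq_right (x := posShift ε z.1)
    (y := posShift ε z.2)).const_mul (truncPow p k (posShift ε z.1))).mul
    (hasDerivAt_rpow_one_sub (p := p) hy)
  refine (h.comp z.2 (hasDerivAt_posShift hε z.2)).congr_deriv ?_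
  have : posShift ε z.2 ^ (1 - p) = posShift ε z.2 ^ (-p) * posShift ε z.2 := by
    rw [← Real.rpow_add_one hy.ne']; congr 1; ring
  rw [this, mul_assoc 2 (relExcess _ _) (1 - _), ← relExcess_mul_div]
  field_simp

end Partials

end Profiles

/-! ### Bounds and limits of the profiles -/

/-- The functions `F` for which `F(v₁, v₂)` is an admissible test function, for any two positive
elements `v₁`, `v₂` of `W^{1,p}_0`. The bound by a multiple of the first variable forces `F(v₁, v₂)`
to vanish on the boundary. -/
structure IsTestProfile (F : ℝ × ℝ → ℝ) : Prop where
  contDiff : ContDiff ℝ 1 F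
  nonneg : ∀ z, 0 ≤ F z
  exists_le : ∃ M, ∀ z, F z ≤ M
  exists_fst_le : ∃ M, ∀ z, |fderiv ℝ F z (1, 0)| ≤ M
  exists_snd_le : ∃ M, ∀ z, |fderiv ℝ F z (0, 1)| ≤ M
  exists_le_mul : ∃ C, ∀ s t, 0 < s → 0 < t → F (s, t) ≤ C * s

lemma mul_relExcess {x y : ℝ} (hx : 0 < x) : x * relExcess x y = max (x - y) 0 := by
  rw [relExcess, mul_max_of_nonneg _ _ hx.le, mul_zero]
  congr 1; field_simp

lemma abs_exp_min_zero_le_one (r : ℝ) : |Real.exp (min r 0)| ≤ 1 := by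
  rw [abs_of_pos (Real.exp_pos _)]
  exact Real.exp_le_one_iff.2 (min_le_right _ _)

section Bounds

variable {p k ε : ℝ}

lemma profileFst_nonneg (hk : 0 < k) (hε : 0 < ε) (z : ℝ × ℝ) : 0 ≤ profileFst p k ε z :=
  mul_nonneg (mul_nonneg (truncPow_pos hk (posShift_pos hε _)).le (sq_nonneg _))
    (Real.rpow_nonneg (posShift_pos hε _).le _)

lemma profileSnd_nonneg (hk : 0 < k) (hε : 0 < ε) (z : ℝ × ℝ) : 0 ≤ profileSnd p k ε z :=
  mul_nonneg (mul_nonneg (truncPow_pos hk (posShift_pos hε _)).le (sq_nonneg _))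
    (Real.rpow_nonneg (posShift_pos hε _).le _)

lemma truncPow_mul_rpow_neg_le_one (hp : 0 ≤ p) (hk : 0 < k) {x : ℝ} (hx : 0 < x) :
    truncPow p k x * x ^ (-p) ≤ 1 := by
  rw [Real.rpow_neg hx.le, ← div_eq_mul_inv, div_le_one (Real.rpow_pos_of_pos hx p)]
  exact truncPow_le_rpow hp hk hx

/-- Elementary bound for the bracket in the first partial derivatives of the profiles. -/
lemma abs_bracket_le (hp : 1 < p) {w κ : ℝ} (hw0 : 0 ≤ w) (hw1 : w ≤ 1) (hκ0 : 0 ≤ κ)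
    (hκ1 : κ ≤ 1) {b : ℝ} (hb0 : 0 ≤ b) (hb : b ≤ 1) :
    |p * κ * w ^ 2 + 2 * w * (1 - w) + b * ((1 - p) * w ^ 2)| ≤ 2 * p + 2 := by
  have h1 : 0 ≤ p * κ * w ^ 2 := by positivity
  have h2 : p * κ * w ^ 2 ≤ p := by
    have : κ * w ^ 2 ≤ 1 := mul_le_one₀ hκ1 (sq_nonneg w) (pow_le_one₀ hw0 hw1)
    nlinarith
  have h3 : 0 ≤ w * (1 - w) := mul_nonneg hw0 (by linarith)
  have h4 : w * (1 - w) ≤ 1 := by nlinarith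
  have h5 : b * w ^ 2 ≤ 1 := mul_le_one₀ hb (sq_nonneg w) (pow_le_one₀ hw0 hw1)
  have h6 : 0 ≤ b * w ^ 2 := by positivity
  rw [abs_le]
  constructor <;> nlinarith

lemma abs_fderiv_profileFst_fst_le (hp : 1 < p) (hk : 0 < k) (hε : 0 < ε) (z : ℝ × ℝ) :
    |fderiv ℝ (profileFst p k ε) z (1, 0)| ≤ 2 * p + 2 := by
  have hx := posShift_pos hε z.1
  have hy := posShift_pos hε z.2
  rw [fderiv_profileFst_fst hk hε z rfl rfl rfl rfl, abs_mul, abs_mul, abs_of_nonneg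
    (mul_nonneg (truncPow_pos hk hx).le (Real.rpow_nonneg hx.le _))]
  have h1 := truncPow_mul_rpow_neg_le_one (by linarith : 0 ≤ p) hk hx
  have h2 := abs_bracket_le hp (relExcess_nonneg (x := posShift ε z.1) (y := posShift ε z.2))
    (relExcess_le_one hx hy) (κ := k / (k + posShift ε z.1)) (by positivity)
    ((div_le_one (by positivity)).2 (by linarith)) zero_le_one le_rfl
  rw [one_mul] at h2
  calc _ ≤ 1 * (2 * p + 2) * 1 := by
        gcongr
        exact abs_exp_min_zero_le_one _
    _ = _ := by ring

lemma abs_fderiv_profileFst_snd_le (hp : 1 < p) (hk : 0 < k) (hε : 0 < ε) (z : ℝ × ℝ) :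
    |fderiv ℝ (profileFst p k ε) z (0, 1)| ≤ 2 * p + 2 := by
  have hx := posShift_pos hε z.1
  have hy := posShift_pos hε z.2
  rw [fderiv_profileFst_snd hk hε z rfl rfl rfl rfl, abs_mul, abs_neg, abs_mul, abs_of_nonneg
    (mul_nonneg (truncPow_pos hk hx).le (Real.rpow_nonneg hx.le _))]
  have h1 := truncPow_mul_rpow_neg_le_one (by linarith : 0 ≤ p) hk hx
  have h0 := relExcess_nonneg (x := posShift ε z.1) (y := posShift ε z.2)
  have h2 := relExcess_le_one hx hy
  have h3 : |2 * relExcess (posShift ε z.1) (posShift ε z.2)| ≤ 2 * p + 2 := by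
    rw [abs_of_nonneg (by positivity)]; linarith
  calc _ ≤ 1 * (2 * p + 2) * 1 := by
        gcongr
        exact abs_exp_min_zero_le_one _
    _ = _ := by ring

lemma profileFst_le (hp : 1 < p) (hk : 0 < k) (hε : 0 < ε) {s t : ℝ} (hs : 0 < s)
    (ht : 0 < t) : profileFst p k ε (s, t) ≤ s * relExcess s t ^ 2 := by
  simp only [profileFst, posShift_of_nonneg hs.le, posShift_of_nonneg ht.le]
  have hx : 0 < s + ε := by positivity
  have h1 : truncPow p k (s + ε) * (s + ε) ^ (1 - p) ≤ s + ε := by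
    have := truncPow_mul_rpow_neg_le_one (by linarith : 0 ≤ p) hk hx
    rw [show 1 - p = -p + 1 by ring, Real.rpow_add_one hx.ne', ← mul_assoc]
    exact mul_le_of_le_one_left hx.le this
  have h2 : relExcess (s + ε) (t + ε) = max (s - t) 0 / (s + ε) := by
    rw [eq_div_iff hx.ne', mul_comm, mul_relExcess hx]; congr 1; ring
  have h3 : relExcess s t = max (s - t) 0 / s := by
    rw [eq_div_iff hs.ne', mul_comm, mul_relExcess hs]
  calc _ = truncPow p k (s + ε) * (s + ε) ^ (1 - p) * relExcess (s + ε) (t + ε) ^ 2 := by ring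
    _ ≤ (s + ε) * relExcess (s + ε) (t + ε) ^ 2 := by gcongr
    _ = max (s - t) 0 ^ 2 / (s + ε) := by rw [h2]; field_simp
    _ ≤ max (s - t) 0 ^ 2 / s := by gcongr; linarith
    _ = s * relExcess s t ^ 2 := by rw [h3]; field_simp

lemma isTestProfile_profileFst (hp : 1 < p) (hk : 0 < k) (hε : 0 < ε) :
    IsTestProfile (profileFst p k ε) where
  contDiff := contDiff_profileFst hk hε
  nonneg := profileFst_nonneg hk hε
  exists_le := by
    refine ⟨k ^ p * 1 * (ε / 2) ^ (1 - p), fun z => ?_⟩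
    have hx := posShift_pos hε z.1
    have hw := pow_le_one₀ (n := 2) relExcess_nonneg (relExcess_le_one hx (posShift_pos hε z.2))
    have h1 := truncPow_le_const (by linarith : 0 ≤ p) hk hx
    have h2 := Real.rpow_le_rpow_of_nonpos (half_pos hε) (half_le_posShift hε z.1)
      (by linarith : 1 - p ≤ 0)
    have h3 := (truncPow_pos (p := p) hk hx).le
    unfold profileFst
    gcongr
  exists_fst_le := ⟨_, abs_fderiv_profileFst_fst_le hp hk hε⟩
  exists_snd_le := ⟨_, abs_fderiv_profileFst_snd_le hp hk hε⟩
  exists_le_mul := by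
    refine ⟨1, fun s t hs ht => (profileFst_le hp hk hε hs ht).trans ?_⟩
    have := pow_le_one₀ (n := 2) relExcess_nonneg (relExcess_le_one hs ht)
    rw [mul_comm]
    gcongr

lemma isTestProfile_profileSnd (hp : 1 < p) (hk : 0 < k) (hε : 0 < ε) :
    IsTestProfile (profileSnd p k ε) where
  contDiff := contDiff_profileSnd hk hε
  nonneg := profileSnd_nonneg hk hε
  exists_le := by
    refine ⟨k ^ p * 1 * (ε / 2) ^ (1 - p), fun z => ?_⟩
    have hx := posShift_pos hε z.1
    have hw := pow_le_one₀ (n := 2) relExcess_nonneg (relExcess_le_one hx (posShift_pos hε z.2))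
    have h1 := truncPow_le_const (by linarith : 0 ≤ p) hk hx
    have h2 := Real.rpow_le_rpow_of_nonpos (half_pos hε) (half_le_posShift hε z.2)
      (by linarith : 1 - p ≤ 0)
    have h3 := (truncPow_pos (p := p) hk hx).le
    have h4 := Real.rpow_nonneg (posShift_pos hε z.2).le (1 - p)
    unfold profileSnd
    gcongr
  exists_fst_le := by
    refine ⟨k ^ p * (ε / 2) ^ (1 - p) / (ε / 2) * (2 * p + 2) * 1, fun z => ?_⟩
    have hx := posShift_pos hε z.1
    have hy := posShift_pos hε z.2
    have hy' := Real.rpow_nonneg hy.le (1 - p)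
    have ht := (truncPow_pos (p := p) hk hx).le
    rw [fderiv_profileSnd_fst hk hε z rfl rfl rfl rfl, abs_mul, abs_mul, abs_of_nonneg
      (div_nonneg (mul_nonneg ht hy') hx.le)]
    have h1 := truncPow_le_const (by linarith : 0 ≤ p) hk hx
    have h2 := Real.rpow_le_rpow_of_nonpos (half_pos hε) (half_le_posShift hε z.2)
      (by linarith : 1 - p ≤ 0)
    have h3 := abs_bracket_le hp (relExcess_nonneg (x := posShift ε z.1) (y := posShift ε z.2))
      (relExcess_le_one hx hy) (κ := k / (k + posShift ε z.1)) (by positivity)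
      ((div_le_one (by positivity)).2 (by linarith)) le_rfl zero_le_one
    rw [zero_mul, add_zero] at h3
    have h4 := half_le_posShift hε z.1
    have h5 := abs_exp_min_zero_le_one (2 * z.1 / ε)
    gcongr
  exists_snd_le := by
    refine ⟨k ^ p * (ε / 2) ^ (-p) * (2 * p + 2) * 1, fun z => ?_⟩
    have hx := posShift_pos hε z.1
    have hy := posShift_pos hε z.2
    have hy' := Real.rpow_nonneg hy.le (-p)
    have ht := (truncPow_pos (p := p) hk hx).le
    rw [fderiv_profileSnd_snd hk hε z rfl rfl rfl rfl, abs_mul, abs_mul, abs_of_nonneg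
      (mul_nonneg ht hy')]
    have h1 := truncPow_le_const (by linarith : 0 ≤ p) hk hx
    have h2 := Real.rpow_le_rpow_of_nonpos (half_pos hε) (half_le_posShift hε z.2)
      (by linarith : -p ≤ 0)
    have h3 : |-(2 * relExcess (posShift ε z.1) (posShift ε z.2) *
        (1 - relExcess (posShift ε z.1) (posShift ε z.2))) +
        (1 - p) * relExcess (posShift ε z.1) (posShift ε z.2) ^ 2| ≤ 2 * p + 2 := by
      have h0 := relExcess_nonneg (x := posShift ε z.1) (y := posShift ε z.2)
      have h1 := relExcess_le_one hx hy
      generalize relExcess (posShift ε z.1) (posShift ε z.2) = w at *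
      have h2 : w ^ 2 ≤ 1 := pow_le_one₀ h0 h1
      have h3 : 0 ≤ w * (1 - w) := mul_nonneg h0 (by linarith)
      rw [abs_le]
      constructor <;> nlinarith
    have h5 := abs_exp_min_zero_le_one (2 * z.2 / ε)
    gcongr
  exists_le_mul := by
    refine ⟨k ^ p * (ε / 2) ^ (1 - p) / ε, fun s t hs ht => ?_⟩
    simp only [profileSnd, posShift_of_nonneg hs.le, posShift_of_nonneg ht.le]
    have hx : 0 < s + ε := by positivity
    have hy : 0 < t + ε := by positivity
    have h1 := truncPow_le_const (by linarith : 0 ≤ p) hk hx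
    have h2 := Real.rpow_le_rpow_of_nonpos (half_pos hε) (by linarith : ε / 2 ≤ t + ε)
      (by linarith : 1 - p ≤ 0)
    have h3 : relExcess (s + ε) (t + ε) ^ 2 ≤ s / ε := by
      have h0 := relExcess_nonneg (x := s + ε) (y := t + ε)
      have h4 := relExcess_le_one hx hy
      have h5 : relExcess (s + ε) (t + ε) ≤ s / ε := by
        rw [le_div_iff₀ hε]
        have := mul_relExcess (y := t + ε) hx
        have h6 : max (s + ε - (t + ε)) 0 ≤ s := max_le (by linarith) hs.le
        nlinarith
      nlinarith
    have h4 := (truncPow_pos (p := p) hk hx).le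
    have h5 := Real.rpow_nonneg hy.le (1 - p)
    calc _ ≤ k ^ p * (s / ε) * (ε / 2) ^ (1 - p) := by gcongr
      _ = _ := by ring

/-- The Picone-type inequality for the two test functions: `P` and `Q` stand for the gradients of
`v₁ = s` and `v₂ = t`. -/
lemma picone_profile {E : Type*} [NormedAddCommGroup E] [InnerProductSpace ℝ E] (hp : 1 < p)
    (hk : 0 < k) (hε : 0 < ε) {s t : ℝ} (hs : 0 < s) (ht : 0 < t) (P Q : E) :
    -((p - 1) * ((s + ε) / (k + (s + ε))) * ‖P‖ ^ p) ≤
      inner ℝ (pFlux p P) (fderiv ℝ (profileFst p k ε) (s, t) (1, 0) • P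
          + fderiv ℝ (profileFst p k ε) (s, t) (0, 1) • Q)
        - inner ℝ (pFlux p Q) (fderiv ℝ (profileSnd p k ε) (s, t) (1, 0) • P
          + fderiv ℝ (profileSnd p k ε) (s, t) (0, 1) • Q) := by
  have hx : 0 < s + ε := by positivity
  have hy : 0 < t + ε := by positivity
  have he (r : ℝ) (hr : 0 < r) : Real.exp (min (2 * r / ε) 0) = 1 := by
    rw [min_eq_right (by positivity), Real.exp_zero]
  have hs' := posShift_of_nonneg (ε := ε) hs.le
  have ht' := posShift_of_nonneg (ε := ε) ht.le
  rw [fderiv_profileFst_fst hk hε (s, t) hs' ht' rfl (he s hs),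
    fderiv_profileFst_snd hk hε (s, t) hs' ht' rfl (he t ht),
    fderiv_profileSnd_fst hk hε (s, t) hs' ht' rfl (he s hs),
    fderiv_profileSnd_snd hk hε (s, t) hs' ht' rfl (he t ht)]
  generalize s + ε = x at *
  generalize t + ε = y at *
  obtain ⟨X, rfl⟩ : ∃ X : E, P = x • X := ⟨x⁻¹ • P, by rw [smul_inv_smul₀ hx.ne']⟩
  obtain ⟨Y, rfl⟩ : ∃ Y : E, Q = y • Y := ⟨y⁻¹ • Q, by rw [smul_inv_smul₀ hy.ne']⟩
  have hw := relExcess_mul_div (x := x) (y := y)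
  have hw0 := relExcess_nonneg (x := x) (y := y)
  have hw1 := relExcess_le_one hx hy
  have hτ0 := (truncPow_pos (p := p) hk hx).le
  have hτ1 := truncPow_mul_rpow_neg_le_one (by linarith : 0 ≤ p) hk hx
  have hκ : 1 - k / (k + x) = x / (k + x) := by field_simp; ring
  have key := picone_normalized hp hw0 hw1 (κ := k / (k + x)) (by positivity)
    ((div_le_one (by positivity)).2 (by linarith)) X Y
  have hXp : 0 ≤ ‖X‖ ^ p := Real.rpow_nonneg (norm_nonneg _) _
  have hx1 : x ^ p * x ^ (-p) = 1 := by rw [← Real.rpow_add hx]; simp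
  have hx2 : x ^ (p - 1) * x ^ (-p) = x⁻¹ := by
    rw [← Real.rpow_add hx, show p - 1 + -p = -1 by ring, Real.rpow_neg_one]
  have hy1 : y ^ p * y ^ (-p) = 1 := by rw [← Real.rpow_add hy]; simp
  have hy2 : y ^ (p - 1) * y ^ (1 - p) = 1 := by rw [← Real.rpow_add hy]; simp
  have e1 : inner ℝ (pFlux p (x • X)) (x • X) = x ^ p * ‖X‖ ^ p := by
    rw [inner_pFlux_self hp, norm_smul, Real.norm_of_nonneg hx.le,
      Real.mul_rpow hx.le (norm_nonneg _)]
  have e2 : inner ℝ (pFlux p (y • Y)) (y • Y) = y ^ p * ‖Y‖ ^ p := by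
    rw [inner_pFlux_self hp, norm_smul, Real.norm_of_nonneg hy.le,
      Real.mul_rpow hy.le (norm_nonneg _)]
  have e3 : inner ℝ (pFlux p (x • X)) (y • Y) = x ^ (p - 1) * y * inner ℝ (pFlux p X) Y := by
    rw [pFlux_smul hx, inner_smul_left, inner_smul_right, RCLike.conj_to_real]; ring
  have e4 : inner ℝ (pFlux p (y • Y)) (x • X) = y ^ (p - 1) * x * inner ℝ (pFlux p Y) X := by
    rw [pFlux_smul hy, inner_smul_left, inner_smul_right, RCLike.conj_to_real]; ring
  have hin (u a b : E) (α β : ℝ) :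
      inner ℝ u (α • a + β • b) = α * inner ℝ u a + β * inner ℝ u b := by
    rw [inner_add_right, real_inner_smul_right, real_inner_smul_right]
  rw [hin, hin, e1, e2, e3, e4]
  simp only [mul_one]
  generalize relExcess x y = w at *
  generalize truncPow p k x = τ at *
  rw [hκ] at key
  have hκ0 : 0 ≤ (p - 1) * (x / (k + x)) := mul_nonneg (by linarith) (by positivity)
  have hle : τ * ((p - 1) * (x / (k + x)) * ‖X‖ ^ p) ≤
      (p - 1) * (x / (k + x)) * ‖x • X‖ ^ p := by
    have : τ ≤ x ^ p := by
      calc τ = τ * x ^ (-p) * x ^ p := by rw [mul_assoc, mul_comm (x ^ (-p)), hx1, mul_one]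
        _ ≤ 1 * x ^ p := by gcongr
        _ = x ^ p := one_mul _
    rw [norm_smul, Real.norm_of_nonneg hx.le, Real.mul_rpow hx.le (norm_nonneg _)]
    calc _ = (p - 1) * (x / (k + x)) * (τ * ‖X‖ ^ p) := by ring
      _ ≤ _ := by gcongr
  have key' := mul_le_mul_of_nonneg_left key hτ0
  refine le_trans (neg_le_neg hle) (le_trans (le_of_eq (by ring)) (le_trans key' (le_of_eq ?_)))
  generalize ‖X‖ ^ p = a at *
  generalize ‖Y‖ ^ p = b at *
  generalize inner ℝ (pFlux p X) Y = c at *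
  generalize inner ℝ (pFlux p Y) X = d at *
  have t1 (B : ℝ) : τ * x ^ (-p) * B * (x ^ p * a) = τ * B * a := by
    calc _ = τ * B * a * (x ^ p * x ^ (-p)) := by ring
      _ = _ := by rw [hx1, mul_one]
  have t2 : -(τ * x ^ (-p) * (2 * w)) * (x ^ (p - 1) * y * c) = -(τ * (2 * w * (1 - w)) * c) := by
    calc _ = -(2 * τ * c * w * y * (x ^ (p - 1) * x ^ (-p))) := by ring
      _ = -(2 * τ * c * (w * (y / x))) := by rw [hx2]; ring
      _ = _ := by rw [hw]; ring
  have t3 (B : ℝ) : τ * y ^ (1 - p) / x * B * (y ^ (p - 1) * x * d) = τ * B * d := by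
    calc _ = τ * B * d * (y ^ (p - 1) * y ^ (1 - p)) * (x / x) := by ring
      _ = _ := by rw [hy2, div_self hx.ne', mul_one, mul_one]
  have t4 (B : ℝ) : τ * y ^ (-p) * B * (y ^ p * b) = τ * B * b := by
    calc _ = τ * B * b * (y ^ p * y ^ (-p)) := by ring
      _ = _ := by rw [hy1, mul_one]
  rw [t1, t2, t3, t4]
  ring

end Bounds

section Limits

variable {p : ℝ} {k ε : ℕ → ℝ} {s t : ℝ}

lemma tendsto_truncPow_mul_relExcess (hk : Tendsto k atTop atTop) (hε0 : ∀ n, 0 < ε n)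
    (hε : Tendsto ε atTop (𝓝 0)) (hp : 0 < p) (hs : 0 < s) (ht : 0 < t) :
    Tendsto (fun n => truncPow p (k n) (posShift (ε n) s) *
      relExcess (posShift (ε n) s) (posShift (ε n) t) ^ 2) atTop
      (𝓝 (s ^ p * relExcess s t ^ 2)) := by
  simp only [posShift_of_nonneg hs.le, posShift_of_nonneg ht.le]
  have hx : Tendsto (fun n => s + ε n) atTop (𝓝 s) := by simpa using hε.const_add s
  have hy : Tendsto (fun n => t + ε n) atTop (𝓝 t) := by simpa using hε.const_add t
  refine Tendsto.mul ?_ ?_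
  · refine Tendsto.rpow_const ?_ (Or.inr hp.le)
    have h1 : Tendsto (fun n => (s + ε n) / (1 + (s + ε n) / k n)) atTop (𝓝 (s / (1 + 0))) :=
      hx.div ((hx.div_atTop hk).const_add 1) (by norm_num)
    rw [add_zero, div_one] at h1
    refine h1.congr' ?_
    filter_upwards [hk.eventually_gt_atTop 0] with n hn
    have := hε0 n
    field_simp
  · exact ((((hy.div hx hs.ne').const_sub 1).max tendsto_const_nhds).pow 2)

lemma tendsto_profileFst (hk : Tendsto k atTop atTop) (hε0 : ∀ n, 0 < ε n)
    (hε : Tendsto ε atTop (𝓝 0)) (hp : 0 < p) (hs : 0 < s) (ht : 0 < t) :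
    Tendsto (fun n => profileFst p (k n) (ε n) (s, t)) atTop
      (𝓝 (s ^ p * relExcess s t ^ 2 * s ^ (1 - p))) := by
  refine (tendsto_truncPow_mul_relExcess hk hε0 hε hp hs ht).mul ?_
  simp only [posShift_of_nonneg hs.le]
  exact Tendsto.rpow_const (by simpa using hε.const_add s) (Or.inl hs.ne')

lemma tendsto_profileSnd (hk : Tendsto k atTop atTop) (hε0 : ∀ n, 0 < ε n)
    (hε : Tendsto ε atTop (𝓝 0)) (hp : 0 < p) (hs : 0 < s) (ht : 0 < t) :
    Tendsto (fun n => profileSnd p (k n) (ε n) (s, t)) atTop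
      (𝓝 (s ^ p * relExcess s t ^ 2 * t ^ (1 - p))) := by
  refine (tendsto_truncPow_mul_relExcess hk hε0 hε hp hs ht).mul ?_
  simp only [posShift_of_nonneg ht.le]
  exact Tendsto.rpow_const (by simpa using hε.const_add t) (Or.inl ht.ne')

end Limits

/-! ### Passing to the limit in the weak formulation -/

section Pairing

variable {α E : Type*} {m : MeasurableSpace α} {μ : Measure α} [NormedAddCommGroup E]
  [InnerProductSpace ℝ E] {p q : ℝ} {A D : α → E}

lemma integrable_inner_smul (hpq : p.HolderConjugate q) (hA : MemLp A (ENNReal.ofReal q) μ)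
    (hD : MemLp D (ENNReal.ofReal p) μ) {c : α → ℝ} (hc : AEStronglyMeasurable c μ) {M : ℝ}
    (hM : ∀ᵐ x ∂μ, |c x| ≤ M) : Integrable (fun x => inner ℝ (A x) (c x • D x)) μ := by
  have : (ENNReal.ofReal q).HolderTriple (ENNReal.ofReal p) 1 :=
    hpq.symm.ennrealOfReal
  have h1 : Integrable (fun x => ‖A x‖ * ‖D x‖) μ := hA.norm.integrable_mul hD.norm
  refine (h1.const_mul M).mono' (hA.1.inner (hc.smul hD.1)) ?_
  filter_upwards [hM] with x hx
  calc _ ≤ ‖A x‖ * ‖c x • D x‖ := norm_inner_le_norm _ _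
    _ = |c x| * (‖A x‖ * ‖D x‖) := by rw [norm_smul, Real.norm_eq_abs]; ring
    _ ≤ _ := by gcongr

/-- Weak-strong convergence in the pairing of `L^q` and `L^p`: the vector fields converge in `L^p`,
their bounded scalar coefficients only almost everywhere. -/
lemma tendsto_integral_inner_smul (hpq : p.HolderConjugate q) (hA : MemLp A (ENNReal.ofReal q) μ)
    (hD : MemLp D (ENNReal.ofReal p) μ) {Dn : ℕ → α → E}
    (hDn : ∀ n, MemLp (Dn n) (ENNReal.ofReal p) μ)
    (hlim : Tendsto (fun n => eLpNorm (fun x => Dn n x - D x) (ENNReal.ofReal p) μ) atTop (𝓝 0))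
    {cn : ℕ → α → ℝ} {c : α → ℝ} (hcn : ∀ n, AEStronglyMeasurable (cn n) μ) {M : ℝ}
    (hM : ∀ n, ∀ᵐ x ∂μ, |cn n x| ≤ M)
    (hc : ∀ᵐ x ∂μ, Tendsto (fun n => cn n x) atTop (𝓝 (c x))) :
    Tendsto (fun n => ∫ x, inner ℝ (A x) (cn n x • Dn n x) ∂μ) atTop
      (𝓝 (∫ x, inner ℝ (A x) (c x • D x) ∂μ)) := by
  have : (ENNReal.ofReal q).HolderTriple (ENNReal.ofReal p) 1 :=
    hpq.symm.ennrealOfReal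
  have h1 : Integrable (fun x => ‖A x‖ * ‖D x‖) μ := hA.norm.integrable_mul hD.norm
  have hdiff (n : ℕ) : MemLp (fun x => Dn n x - D x) (ENNReal.ofReal p) μ := (hDn n).sub hD
  have hfst : Tendsto (fun n => ∫ x, inner ℝ (A x) (cn n x • (Dn n x - D x)) ∂μ) atTop (𝓝 0) := by
    have hb (n : ℕ) : eLpNorm (fun x => inner ℝ (A x) (cn n x • (Dn n x - D x))) 1 μ ≤
        M.toNNReal * eLpNorm A (ENNReal.ofReal q) μ *
          eLpNorm (fun x => Dn n x - D x) (ENNReal.ofReal p) μ := by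
      have h2 : eLpNorm (fun x => ‖A x‖ * ‖Dn n x - D x‖) 1 μ ≤
          1 * eLpNorm A (ENNReal.ofReal q) μ *
            eLpNorm (fun x => Dn n x - D x) (ENNReal.ofReal p) μ := by
        refine eLpNorm_le_eLpNorm_mul_eLpNorm'_of_norm hA.1 (hdiff n).1
          (fun a b => ‖a‖ * ‖b‖) 1 (Eventually.of_forall fun x => ?_)
        simp
      have h3 : eLpNorm (fun x => inner ℝ (A x) (cn n x • (Dn n x - D x))) 1 μ ≤
          ENNReal.ofReal M * eLpNorm (fun x => ‖A x‖ * ‖Dn n x - D x‖) 1 μ := by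
        refine eLpNorm_le_mul_eLpNorm_of_ae_le_mul ?_ 1
        filter_upwards [hM n] with x hx
        calc _ ≤ ‖A x‖ * ‖cn n x • (Dn n x - D x)‖ := norm_inner_le_norm _ _
          _ = |cn n x| * (‖A x‖ * ‖Dn n x - D x‖) := by
            rw [norm_smul, Real.norm_eq_abs]; ring
          _ ≤ M * (‖A x‖ * ‖Dn n x - D x‖) := by gcongr
          _ = _ := by rw [norm_mul, norm_norm, norm_norm]
      refine h3.trans ?_
      rw [mul_assoc]
      rw [one_mul] at h2
      exact mul_le_mul_right h2 _
    have hz : Tendsto (fun n => (M.toNNReal * eLpNorm A (ENNReal.ofReal q) μ *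
          eLpNorm (fun x => Dn n x - D x) (ENNReal.ofReal p) μ : ENNReal)) atTop (𝓝 0) := by
      have := ENNReal.Tendsto.const_mul (a := M.toNNReal * eLpNorm A (ENNReal.ofReal q) μ) hlim
        (Or.inr (ENNReal.mul_ne_top ENNReal.coe_ne_top hA.eLpNorm_ne_top))
      simpa using this
    have := tendsto_integral_of_L1' (μ := μ) (fun _ => (0 : ℝ)) aestronglyMeasurable_const
      (F := fun n x => inner ℝ (A x) (cn n x • (Dn n x - D x))) (l := atTop)
      (Eventually.of_forall fun n => integrable_inner_smul hpq hA (hdiff n) (hcn n) (hM n))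
      (tendsto_of_tendsto_of_tendsto_of_le_of_le tendsto_const_nhds hz (fun _ => zero_le)
        fun n => by simpa [Pi.sub_def] using hb n)
    simpa using this
  have hsnd : Tendsto (fun n => ∫ x, inner ℝ (A x) (cn n x • D x) ∂μ) atTop
      (𝓝 (∫ x, inner ℝ (A x) (c x • D x) ∂μ)) := by
    refine tendsto_integral_of_dominated_convergence (fun x => M * (‖A x‖ * ‖D x‖))
      (fun n => hA.1.inner ((hcn n).smul hD.1)) (h1.const_mul M) (fun n => ?_) ?_
    · filter_upwards [hM n] with x hx
      calc _ ≤ ‖A x‖ * ‖cn n x • D x‖ := norm_inner_le_norm _ _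
        _ = |cn n x| * (‖A x‖ * ‖D x‖) := by rw [norm_smul, Real.norm_eq_abs]; ring
        _ ≤ _ := by gcongr
    · filter_upwards [hc] with x hx
      exact tendsto_const_nhds.inner (hx.smul_const _)
  have := hfst.add hsnd
  rw [zero_add] at this
  refine this.congr fun n => ?_
  rw [← integral_add (integrable_inner_smul hpq hA (hdiff n) (hcn n) (hM n))
    (integrable_inner_smul hpq hA hD (hcn n) (hM n))]
  refine integral_congr_ae (Eventually.of_forall fun x => ?_)
  change _ + _ = _
  rw [← inner_add_right, ← smul_add, sub_add_cancel]

end Pairing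

/-- Fatou's lemma for real functions converging almost everywhere. -/
lemma lintegral_ofReal_le_of_tendsto {α : Type*} {m : MeasurableSpace α} {μ : Measure α}
    {f : ℕ → α → ℝ} {g : α → ℝ} {l : ℕ → ℝ} {a : ℝ} (hf : ∀ n, AEStronglyMeasurable (f n) μ)
    (hfg : ∀ᵐ x ∂μ, Tendsto (fun n => f n x) atTop (𝓝 (g x)))
    (hl : ∀ n, ∫⁻ x, ENNReal.ofReal (f n x) ∂μ ≤ ENNReal.ofReal (l n))
    (hla : Tendsto l atTop (𝓝 a)) :
    ∫⁻ x, ENNReal.ofReal (g x) ∂μ ≤ ENNReal.ofReal a := by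
  have h1 : ∫⁻ x, ENNReal.ofReal (g x) ∂μ =
      ∫⁻ x, liminf (fun n => ENNReal.ofReal (f n x)) atTop ∂μ := by
    refine lintegral_congr_ae ?_
    filter_upwards [hfg] with x hx
    exact ((ENNReal.continuous_ofReal.tendsto _).comp hx).liminf_eq.symm
  rw [h1]
  refine (lintegral_liminf_le' fun n => (hf n).aemeasurable.ennreal_ofReal).trans ?_
  rw [← ((ENNReal.continuous_ofReal.tendsto _).comp hla).liminf_eq]
  exact liminf_le_liminf (Eventually.of_forall hl)

/-! ### Test functions and cut-offs -/

section TestFunction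

variable {N : ℕ} {Ω : Set (EuclideanSpace ℝ (Fin N))} {φ ψ : EuclideanSpace ℝ (Fin N) → ℝ}

lemma IsTestFunction.memLp_gradient {k : WithTop ℕ∞} (hφ : IsTestFunction k Ω φ) (hk : 1 ≤ k)
    (r : ENNReal) : MemLp (∇ φ) r (volume.restrict Ω) := by
  have h1 : Continuous (∇ φ) :=
    (InnerProductSpace.toDual ℝ _).symm.continuous.comp
      ((hφ.contDiff.of_le hk).continuous_fderiv one_ne_zero)
  have h2 : HasCompactSupport (∇ φ) :=
    (hφ.hasCompactSupport.fderiv ℝ).comp_left (g := (InnerProductSpace.toDual ℝ _).symm)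
      (map_zero _)
  exact (h1.memLp_of_hasCompactSupport h2).restrict Ω

lemma gradient_comp_mul_comp {χ : EuclideanSpace ℝ (Fin N) → ℝ} {F : ℝ × ℝ → ℝ} {θ θ' : ℝ → ℝ}
    (hF : ContDiff ℝ 1 F) (hθ : ∀ s, HasDerivAt θ (θ' s) s) (hφ : Differentiable ℝ φ)
    (hψ : Differentiable ℝ ψ) (hχ : Differentiable ℝ χ) (x : EuclideanSpace ℝ (Fin N)) :
    ∇ (fun x => F (φ x, ψ x) * θ (χ x)) x =
      (θ (χ x) * fderiv ℝ F (φ x, ψ x) (1, 0)) • ∇ φ x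
        + (θ (χ x) * fderiv ℝ F (φ x, ψ x) (0, 1)) • ∇ ψ x
        + (F (φ x, ψ x) * θ' (χ x)) • ∇ χ x := by
  have h1 : HasFDerivAt (fun x => F (φ x, ψ x))
      ((fderiv ℝ F (φ x, ψ x)).comp ((fderiv ℝ φ x).prod (fderiv ℝ ψ x))) x :=
    ((hF.differentiable one_ne_zero _).hasFDerivAt).comp x
      ((hφ x).hasFDerivAt.prodMk (hψ x).hasFDerivAt)
  have h2 : HasFDerivAt (fun x => θ (χ x)) (θ' (χ x) • fderiv ℝ χ x) x :=
    (hθ (χ x)).comp_hasFDerivAt x (hχ x).hasFDerivAt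
  refine ext_inner_right ℝ fun v => ?_
  rw [inner_gradient_left, (h1.fun_mul h2).fderiv, inner_add_left, inner_add_left,
    real_inner_smul_left, real_inner_smul_left, real_inner_smul_left, inner_gradient_left,
    inner_gradient_left, inner_gradient_left]
  have h3 (a b : ℝ) (T : ℝ × ℝ →L[ℝ] ℝ) : T (a, b) = a * T (1, 0) + b * T (0, 1) := by
    rw [← smul_eq_mul, ← smul_eq_mul b, ← map_smul, ← map_smul, ← map_add]
    simp
  simp only [add_apply, smul_apply,
    ContinuousLinearMap.comp_apply, ContinuousLinearMap.prod_apply, smul_eq_mul]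
  rw [h3]
  ring

end TestFunction

/-- A smooth cut-off vanishing at `0` and tending to `1` elsewhere as `j → ∞`. -/
noncomputable def cutoff (j : ℕ) (s : ℝ) : ℝ := j * s ^ 2 / (1 + j * s ^ 2)

/-- The derivative of `cutoff j`. -/
noncomputable def cutoffDeriv (j : ℕ) (s : ℝ) : ℝ := 2 * j * s / (1 + j * s ^ 2) ^ 2

section Cutoff

variable (j : ℕ) (s : ℝ)

lemma one_add_mul_sq_pos : (0 : ℝ) < 1 + j * s ^ 2 := by positivity

lemma hasDerivAt_cutoff : HasDerivAt (cutoff j) (cutoffDeriv j s) s := by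
  have h0 := one_add_mul_sq_pos j s
  have h1 := (hasDerivAt_pow 2 s).const_mul (j : ℝ)
  refine (h1.div (h1.const_add 1) h0.ne').congr_deriv ?_
  rw [cutoffDeriv]
  congr 1
  push_cast
  ring

lemma contDiff_cutoff : ContDiff ℝ 1 (cutoff j) :=
  (contDiff_const.mul (contDiff_id.pow 2)).div
    (contDiff_const.add (contDiff_const.mul (contDiff_id.pow 2)))
    fun s => (one_add_mul_sq_pos j s).ne'

lemma continuous_cutoffDeriv : Continuous (cutoffDeriv j) := by
  refine Continuous.div (by fun_prop) (by fun_prop) fun s => ?_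
  exact (pow_pos (one_add_mul_sq_pos j s) 2).ne'

lemma cutoff_nonneg : 0 ≤ cutoff j s := by
  have := one_add_mul_sq_pos j s
  unfold cutoff
  positivity

lemma cutoff_le_one : cutoff j s ≤ 1 :=
  (div_le_one (one_add_mul_sq_pos j s)).2 (by linarith)

lemma abs_cutoff_le_one : |cutoff j s| ≤ 1 := by
  rw [abs_of_nonneg (cutoff_nonneg j s)]
  exact cutoff_le_one j s

lemma cutoff_zero : cutoff j 0 = 0 := by simp [cutoff]

lemma abs_cutoffDeriv_le : |cutoffDeriv j s| ≤ j + 1 := by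
  have h0 := one_add_mul_sq_pos j s
  have h1 : |2 * j * s| ≤ (j + 1) * (1 + j * s ^ 2) := by
    have hj : (0 : ℝ) ≤ j := by positivity
    have h2 : |2 * s| ≤ 1 + s ^ 2 := abs_le.2 ⟨by nlinarith [sq_nonneg (s + 1)],
      by nlinarith [sq_nonneg (s - 1)]⟩
    calc |2 * j * s| = j * |2 * s| := by
          rw [show 2 * j * s = j * (2 * s) by ring, abs_mul, abs_of_nonneg hj]
      _ ≤ j * (1 + s ^ 2) := by gcongr
      _ ≤ _ := by nlinarith [mul_nonneg (mul_nonneg hj hj) (sq_nonneg s)]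
  rw [cutoffDeriv, abs_div, abs_of_pos (pow_pos h0 2), div_le_iff₀ (pow_pos h0 2)]
  have h3 : (1 : ℝ) ≤ 1 + j * s ^ 2 := by linarith [show (0 : ℝ) ≤ j * s ^ 2 by positivity]
  calc |2 * j * s| ≤ (j + 1) * (1 + j * s ^ 2) := h1
    _ ≤ (j + 1) * (1 + j * s ^ 2) ^ 2 := by gcongr; nlinarith

lemma abs_mul_cutoffDeriv_le : |s * cutoffDeriv j s| ≤ 1 := by
  have h0 := one_add_mul_sq_pos j s
  have h1 : s * cutoffDeriv j s = 2 * (j * s ^ 2) / (1 + j * s ^ 2) ^ 2 := by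
    rw [cutoffDeriv]; ring
  rw [h1, abs_of_nonneg (by positivity), div_le_one (by positivity)]
  nlinarith [sq_nonneg ((j : ℝ) * s ^ 2)]

variable {s}

lemma tendsto_mul_sq_atTop (hs : 0 < s) :
    Tendsto (fun j : ℕ => 1 + (j : ℝ) * s ^ 2) atTop atTop :=
  tendsto_atTop_add_const_left _ _
    (tendsto_natCast_atTop_atTop.atTop_mul_const (by positivity))

lemma tendsto_cutoff (hs : 0 < s) : Tendsto (fun j => cutoff j s) atTop (𝓝 1) := by
  have h := (tendsto_mul_sq_atTop hs).inv_tendsto_atTop.const_sub 1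
  rw [sub_zero] at h
  refine h.congr fun j => ?_
  have h0 := one_add_mul_sq_pos j s
  simp only [Pi.inv_apply, cutoff]
  field_simp
  ring

lemma tendsto_cutoffDeriv (hs : 0 < s) : Tendsto (fun j => cutoffDeriv j s) atTop (𝓝 0) := by
  have h := ((tendsto_cutoff hs).mul (tendsto_mul_sq_atTop hs).inv_tendsto_atTop).const_mul (2 / s)
  rw [mul_zero, mul_zero] at h
  refine h.congr fun j => ?_
  have h0 := one_add_mul_sq_pos j s
  simp only [Pi.inv_apply, cutoff, cutoffDeriv]
  field_simp

end Cutoff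

/-! ### Admissible test functions -/

section Testing

variable {N : ℕ} {p : ℝ} {Ω : Set (EuclideanSpace ℝ (Fin N))}
  {v v₁ v₂ g : EuclideanSpace ℝ (Fin N) → ℝ}
  {Dv D₁ D₂ A : EuclideanSpace ℝ (Fin N) → EuclideanSpace ℝ (Fin N)}

lemma MemSobolevZero.exists_approx_ae (hp : 1 < p) (h : MemSobolevZero p Ω v Dv) :
    ∃ φ : ℕ → EuclideanSpace ℝ (Fin N) → ℝ, (∀ n, IsTestFunction 1 Ω (φ n)) ∧
      (∀ᵐ x ∂(volume.restrict Ω), Tendsto (fun n => φ n x) atTop (𝓝 (v x))) ∧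
      Tendsto (fun n => eLpNorm (fun x => ∇ (φ n) x - Dv x) (ENNReal.ofReal p)
        (volume.restrict Ω)) atTop (𝓝 0) := by
  obtain ⟨φ, hφ, h1, h2⟩ := h.exists_approx
  have hp0 : ENNReal.ofReal p ≠ 0 := by simp; linarith
  obtain ⟨ns, hns, hae⟩ := (tendstoInMeasure_of_tendsto_eLpNorm hp0
    (fun n => (hφ n).contDiff.continuous.aestronglyMeasurable) h.memLp.1 h1).exists_seq_tendsto_ae
  refine ⟨fun n => φ (ns n), fun n => ?_, hae, h2.comp hns.tendsto_atTop⟩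
  exact ⟨(hφ _).contDiff.of_le (by norm_cast), (hφ _).hasCompactSupport, (hφ _).tsupport_subset⟩

lemma IsTestFunction.comp_mul_cutoff {φ ψ χ : EuclideanSpace ℝ (Fin N) → ℝ}
    (hφ : IsTestFunction 1 Ω φ) (hψ : IsTestFunction 1 Ω ψ) (hχ : IsTestFunction 1 Ω χ)
    {F : ℝ × ℝ → ℝ} (hF : ContDiff ℝ 1 F) (j : ℕ) :
    IsTestFunction 1 Ω fun x => F (φ x, ψ x) * cutoff j (χ x) where
  contDiff := (hF.comp (hφ.contDiff.prodMk hψ.contDiff)).mul ((contDiff_cutoff j).comp hχ.contDiff)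
  hasCompactSupport :=
    (hχ.hasCompactSupport.comp_left (g := cutoff j) (cutoff_zero j)).mul_left
  tsupport_subset :=
    (tsupport_mul_subset_right.trans (tsupport_comp_subset (cutoff_zero j) χ)).trans
      hχ.tsupport_subset

/-- If `-div A = g ≥ 0` in the sense of distributions, with `A ∈ L^{p'}` and `g ∈ L^1_loc`, then
`F(v₁, v₂)` may be used as a test function for every `F` as in `IsTestProfile`. No integrability of
`g F(v₁, v₂)` is assumed; it is part of the conclusion. The test functions
`F(φ_m, ψ_m) θ_j(φ_n)` are used, with `φ_m → v₁`, `ψ_m → v₂` smooth and `θ_j` the cut-off: for fixed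
`j`, `n` they live on a fixed compact set, so that one can let `m → ∞`; then Fatou's lemma for
`n → ∞` and `j → ∞` gives one inequality, and `θ_j ≤ 1` the other. -/
lemma lintegral_ofReal_mul_profile (hp : 1 < p)
    (h₁ : MemSobolevZero p Ω v₁ D₁) (h₂ : MemSobolevZero p Ω v₂ D₂)
    (hpos₁ : ∀ᵐ x ∂(volume.restrict Ω), 0 < v₁ x) (hpos₂ : ∀ᵐ x ∂(volume.restrict Ω), 0 < v₂ x)
    (hA : MemLp A (ENNReal.ofReal (Real.conjExponent p)) (volume.restrict Ω))
    (hg : LocallyIntegrableOn g Ω) (hg0 : ∀ᵐ x ∂(volume.restrict Ω), 0 ≤ g x)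
    (heq : ∀ φ : EuclideanSpace ℝ (Fin N) → ℝ, IsTestFunction 1 Ω φ →
      ∫ x in Ω, inner ℝ (A x) (∇ φ x) = ∫ x in Ω, g x * φ x)
    {F : ℝ × ℝ → ℝ} (hF : IsTestProfile F) :
    0 ≤ ∫ x in Ω, inner ℝ (A x) (fderiv ℝ F (v₁ x, v₂ x) (1, 0) • D₁ x
        + fderiv ℝ F (v₁ x, v₂ x) (0, 1) • D₂ x) ∧
      ∫⁻ x in Ω, ENNReal.ofReal (g x * F (v₁ x, v₂ x)) =
        ENNReal.ofReal (∫ x in Ω, inner ℝ (A x) (fderiv ℝ F (v₁ x, v₂ x) (1, 0) • D₁ x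
          + fderiv ℝ F (v₁ x, v₂ x) (0, 1) • D₂ x)) := by
  have hpq := Real.HolderConjugate.conjExponent hp
  obtain ⟨φ, hφ, hφae, hφD⟩ := h₁.exists_approx_ae hp
  obtain ⟨ψ, hψ, hψae, hψD⟩ := h₂.exists_approx_ae hp
  obtain ⟨M, hM⟩ := hF.exists_le
  obtain ⟨M₁, hM₁⟩ := hF.exists_fst_le
  obtain ⟨M₂, hM₂⟩ := hF.exists_snd_le
  obtain ⟨C, hC⟩ := hF.exists_le_mul
  have hM0 : 0 ≤ M := (hF.nonneg 0).trans (hM 0)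
  have hFabs (z : ℝ × ℝ) : |F z| ≤ M := by rw [abs_of_nonneg (hF.nonneg z)]; exact hM z
  have hFc : Continuous F := hF.contDiff.continuous
  have hF' : Continuous (fderiv ℝ F) := hF.contDiff.continuous_fderiv one_ne_zero
  have hF₁c : Continuous fun z => fderiv ℝ F z (1, 0) := hF'.clm_apply continuous_const
  have hF₂c : Continuous fun z => fderiv ℝ F z (0, 1) := hF'.clm_apply continuous_const
  have hφc (n : ℕ) : Continuous (φ n) := (hφ n).contDiff.continuous
  have hψc (n : ℕ) : Continuous (ψ n) := (hψ n).contDiff.continuous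
  have hφL (n : ℕ) : MemLp (∇ (φ n)) (ENNReal.ofReal p) (volume.restrict Ω) :=
    (hφ n).memLp_gradient le_rfl _
  have hψL (n : ℕ) : MemLp (∇ (ψ n)) (ENNReal.ofReal p) (volume.restrict Ω) :=
    (hψ n).memLp_gradient le_rfl _
  have hD₁ := h₁.memLp_grad
  have hD₂ := h₂.memLp_grad
  have hvm : AEStronglyMeasurable (fun x => (v₁ x, v₂ x)) (volume.restrict Ω) :=
    h₁.memLp.1.prodMk h₂.memLp.1
  have hgm : AEStronglyMeasurable g (volume.restrict Ω) := hg.aestronglyMeasurable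
  have hFm := hFc.comp_aestronglyMeasurable hvm
  have hF₁m := hF₁c.comp_aestronglyMeasurable hvm
  have hF₂m := hF₂c.comp_aestronglyMeasurable hvm
  have hconst {D : EuclideanSpace ℝ (Fin N) → EuclideanSpace ℝ (Fin N)} :
      Tendsto (fun _ : ℕ => eLpNorm (fun x => D x - D x) (ENNReal.ofReal p)
        (volume.restrict Ω)) atTop (𝓝 0) := by simp
  have hvlim : ∀ᵐ x ∂(volume.restrict Ω),
      Tendsto (fun m => (φ m x, ψ m x)) atTop (𝓝 (v₁ x, v₂ x)) := by
    filter_upwards [hφae, hψae] with x hx hy using hx.prodMk_nhds hy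
  have hbd {a b c : ℝ} (ha : |a| ≤ 1) (hb : |b| ≤ c) : |a * b| ≤ c := by
    rw [abs_mul]
    exact (mul_le_of_le_one_left (abs_nonneg _) ha).trans hb
  have hθm (j : ℕ) : AEStronglyMeasurable (fun x => cutoff j (v₁ x)) (volume.restrict Ω) :=
    (contDiff_cutoff j).continuous.comp_aestronglyMeasurable h₁.memLp.1
  have hθ'm (j : ℕ) : AEStronglyMeasurable (fun x => cutoffDeriv j (v₁ x)) (volume.restrict Ω) :=
    (continuous_cutoffDeriv j).comp_aestronglyMeasurable h₁.memLp.1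
  have hθφ (j n : ℕ) : Continuous fun x => cutoff j (φ n x) :=
    (contDiff_cutoff j).continuous.comp (hφc n)
  have hθ'φ (j n : ℕ) : Continuous fun x => cutoffDeriv j (φ n x) :=
    (continuous_cutoffDeriv j).comp (hφc n)
  set I : (EuclideanSpace ℝ (Fin N) → ℝ) →
      (EuclideanSpace ℝ (Fin N) → EuclideanSpace ℝ (Fin N)) → ℝ :=
    fun c D => ∫ x in Ω, inner ℝ (A x) (c x • D x) with hI
  set L : ℕ → ℕ → ℝ := fun j n =>
    I (fun x => cutoff j (φ n x) * fderiv ℝ F (v₁ x, v₂ x) (1, 0)) D₁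
      + I (fun x => cutoff j (φ n x) * fderiv ℝ F (v₁ x, v₂ x) (0, 1)) D₂
      + I (fun x => F (v₁ x, v₂ x) * cutoffDeriv j (φ n x)) (∇ (φ n))
  -- `m → ∞`
  have step1 (j n : ℕ) :
      Integrable (fun x => g x * (F (v₁ x, v₂ x) * cutoff j (φ n x))) (volume.restrict Ω) ∧
      ∫ x in Ω, g x * (F (v₁ x, v₂ x) * cutoff j (φ n x)) = L j n := by
    have hbound : Integrable
        ((tsupport (φ n)).indicator fun x => M * ‖g x‖) (volume.restrict Ω) := by
      rw [integrable_indicator_iff (isClosed_tsupport _).measurableSet, IntegrableOn,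
        Measure.restrict_restrict (isClosed_tsupport _).measurableSet,
        inter_eq_self_of_subset_left (hφ n).tsupport_subset]
      exact (hg.integrableOn_compact_subset (hφ n).tsupport_subset
        (hφ n).hasCompactSupport).norm.const_mul M
    have hle (z : ℝ × ℝ) (x : EuclideanSpace ℝ (Fin N)) : ‖g x * (F z * cutoff j (φ n x))‖ ≤
        (tsupport (φ n)).indicator (fun x => M * ‖g x‖) x := by
      by_cases hx : x ∈ tsupport (φ n)
      · rw [indicator_of_mem hx, norm_mul, mul_comm]
        gcongr
        rw [mul_comm]
        exact hbd (abs_cutoff_le_one j _) (hFabs z)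
      · rw [indicator_of_notMem hx, image_eq_zero_of_notMem_tsupport hx, cutoff_zero]
        simp
    refine ⟨hbound.mono' (hgm.mul (hFm.mul (hθφ j n).aestronglyMeasurable))
      (Eventually.of_forall fun x => hle _ x), ?_⟩
    have hrhs : Tendsto (fun m => ∫ x in Ω, g x * (F (φ m x, ψ m x) * cutoff j (φ n x))) atTop
        (𝓝 (∫ x in Ω, g x * (F (v₁ x, v₂ x) * cutoff j (φ n x)))) := by
      refine tendsto_integral_of_dominated_convergence _ (fun m => ?_) hbound
        (fun m => Eventually.of_forall fun x => hle _ x) ?_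
      · exact hgm.mul (((hFc.comp ((hφc m).prodMk (hψc m))).mul (hθφ j n)).aestronglyMeasurable)
      · filter_upwards [hvlim] with x hx
        exact (((hFc.tendsto _).comp hx).mul_const _).const_mul _
    refine tendsto_nhds_unique hrhs ?_
    have ha := tendsto_integral_inner_smul hpq hA hD₁ hφL hφD
      (cn := fun m x => cutoff j (φ n x) * fderiv ℝ F (φ m x, ψ m x) (1, 0))
      (c := fun x => cutoff j (φ n x) * fderiv ℝ F (v₁ x, v₂ x) (1, 0)) (M := M₁)
      (fun m => ((hθφ j n).mul (hF₁c.comp ((hφc m).prodMk (hψc m)))).aestronglyMeasurable)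
      (fun m => Eventually.of_forall fun x => hbd (abs_cutoff_le_one j _) (hM₁ _))
      (by filter_upwards [hvlim] with x hx using ((hF₁c.tendsto _).comp hx).const_mul _)
    have hb := tendsto_integral_inner_smul hpq hA hD₂ hψL hψD
      (cn := fun m x => cutoff j (φ n x) * fderiv ℝ F (φ m x, ψ m x) (0, 1))
      (c := fun x => cutoff j (φ n x) * fderiv ℝ F (v₁ x, v₂ x) (0, 1)) (M := M₂)
      (fun m => ((hθφ j n).mul (hF₂c.comp ((hφc m).prodMk (hψc m)))).aestronglyMeasurable)
      (fun m => Eventually.of_forall fun x => hbd (abs_cutoff_le_one j _) (hM₂ _))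
      (by filter_upwards [hvlim] with x hx using ((hF₂c.tendsto _).comp hx).const_mul _)
    have hc := tendsto_integral_inner_smul hpq hA (hφL n) (fun _ => hφL n) hconst
      (cn := fun m x => F (φ m x, ψ m x) * cutoffDeriv j (φ n x))
      (c := fun x => F (v₁ x, v₂ x) * cutoffDeriv j (φ n x)) (M := M * (j + 1))
      (fun m => ((hFc.comp ((hφc m).prodMk (hψc m))).mul (hθ'φ j n)).aestronglyMeasurable)
      (fun m => Eventually.of_forall fun x => by
        rw [abs_mul]
        exact mul_le_mul (hFabs _) (abs_cutoffDeriv_le j _) (abs_nonneg _) hM0)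
      (by filter_upwards [hvlim] with x hx using ((hFc.tendsto _).comp hx).mul_const _)
    refine ((ha.add hb).add hc).congr fun m => ?_
    have ia : Integrable (fun x => inner ℝ (A x)
        ((cutoff j (φ n x) * fderiv ℝ F (φ m x, ψ m x) (1, 0)) • ∇ (φ m) x))
        (volume.restrict Ω) := integrable_inner_smul hpq hA (hφL m)
      ((hθφ j n).mul (hF₁c.comp ((hφc m).prodMk (hψc m)))).aestronglyMeasurable
      (Eventually.of_forall fun x => hbd (abs_cutoff_le_one j _) (hM₁ _))
    have ib : Integrable (fun x => inner ℝ (A x)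
        ((cutoff j (φ n x) * fderiv ℝ F (φ m x, ψ m x) (0, 1)) • ∇ (ψ m) x))
        (volume.restrict Ω) := integrable_inner_smul hpq hA (hψL m)
      ((hθφ j n).mul (hF₂c.comp ((hφc m).prodMk (hψc m)))).aestronglyMeasurable
      (Eventually.of_forall fun x => hbd (abs_cutoff_le_one j _) (hM₂ _))
    have ic : Integrable (fun x => inner ℝ (A x)
        ((F (φ m x, ψ m x) * cutoffDeriv j (φ n x)) • ∇ (φ n) x))
        (volume.restrict Ω) := integrable_inner_smul hpq hA (hφL n) (M := M * (j + 1))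
      ((hFc.comp ((hφc m).prodMk (hψc m))).mul (hθ'φ j n)).aestronglyMeasurable
      (Eventually.of_forall fun x => by
        rw [abs_mul]
        exact mul_le_mul (hFabs _) (abs_cutoffDeriv_le j _) (abs_nonneg _) hM0)
    rw [← heq _ ((hφ m).comp_mul_cutoff (hψ m) (hφ n) hF.contDiff j), ← integral_add ia ib,
      ← integral_add (ia.fun_add ib) ic]
    refine integral_congr_ae (Eventually.of_forall fun x => ?_)
    change inner ℝ _ _ + inner ℝ _ _ + inner ℝ _ _ = inner ℝ (A x) _
    rw [gradient_comp_mul_comp hF.contDiff (hasDerivAt_cutoff j)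
      ((hφ m).contDiff.differentiable one_ne_zero) ((hψ m).contDiff.differentiable one_ne_zero)
      ((hφ n).contDiff.differentiable one_ne_zero) x, inner_add_right, inner_add_right]
  have hnn (j n : ℕ) : 0 ≤ᵐ[volume.restrict Ω]
      fun x => g x * (F (v₁ x, v₂ x) * cutoff j (φ n x)) := by
    filter_upwards [hg0] with x hx
    exact mul_nonneg hx (mul_nonneg (hF.nonneg _) (cutoff_nonneg j _))
  have step1' (j n : ℕ) :
      ∫⁻ x in Ω, ENNReal.ofReal (g x * (F (v₁ x, v₂ x) * cutoff j (φ n x))) =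
        ENNReal.ofReal (L j n) := by
    rw [← (step1 j n).2, ofReal_integral_eq_lintegral_ofReal (step1 j n).1 (hnn j n)]
  have hL0 (j n : ℕ) : 0 ≤ L j n := by
    rw [← (step1 j n).2]
    exact integral_nonneg_of_ae (hnn j n)
  -- `n → ∞`
  set L' : ℕ → ℝ := fun j =>
    I (fun x => cutoff j (v₁ x) * fderiv ℝ F (v₁ x, v₂ x) (1, 0)) D₁
      + I (fun x => cutoff j (v₁ x) * fderiv ℝ F (v₁ x, v₂ x) (0, 1)) D₂
      + I (fun x => F (v₁ x, v₂ x) * cutoffDeriv j (v₁ x)) D₁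
  have step2 (j : ℕ) : Tendsto (fun n => L j n) atTop (𝓝 (L' j)) := by
    refine Tendsto.add (Tendsto.add ?_ ?_) ?_
    · refine tendsto_integral_inner_smul hpq hA hD₁ (fun _ => hD₁) hconst (M := M₁)
        (fun n => (hθφ j n).aestronglyMeasurable.mul hF₁m)
        (fun n => Eventually.of_forall fun x => hbd (abs_cutoff_le_one j _) (hM₁ _)) ?_
      filter_upwards [hφae] with x hx
      exact (((contDiff_cutoff j).continuous.tendsto _).comp hx).mul_const _
    · refine tendsto_integral_inner_smul hpq hA hD₂ (fun _ => hD₂) hconst (M := M₂)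
        (fun n => (hθφ j n).aestronglyMeasurable.mul hF₂m)
        (fun n => Eventually.of_forall fun x => hbd (abs_cutoff_le_one j _) (hM₂ _)) ?_
      filter_upwards [hφae] with x hx
      exact (((contDiff_cutoff j).continuous.tendsto _).comp hx).mul_const _
    · refine tendsto_integral_inner_smul hpq hA hD₁ hφL hφD (M := M * (j + 1))
        (fun n => hFm.mul (hθ'φ j n).aestronglyMeasurable)
        (fun n => Eventually.of_forall fun x => ?_) ?_
      · rw [abs_mul]
        exact mul_le_mul (hFabs _) (abs_cutoffDeriv_le j _) (abs_nonneg _) hM0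
      · filter_upwards [hφae] with x hx
        exact (((continuous_cutoffDeriv j).tendsto _).comp hx).const_mul _
  -- `j → ∞`; the bound `F(s, t) ≤ C s` controls the derivative of the cut-off
  have step3 : Tendsto L' atTop (𝓝 (∫ x in Ω, inner ℝ (A x)
      (fderiv ℝ F (v₁ x, v₂ x) (1, 0) • D₁ x + fderiv ℝ F (v₁ x, v₂ x) (0, 1) • D₂ x))) := by
    have hsum : ∫ x in Ω, inner ℝ (A x)
        (fderiv ℝ F (v₁ x, v₂ x) (1, 0) • D₁ x + fderiv ℝ F (v₁ x, v₂ x) (0, 1) • D₂ x) =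
        I (fun x => fderiv ℝ F (v₁ x, v₂ x) (1, 0)) D₁
          + I (fun x => fderiv ℝ F (v₁ x, v₂ x) (0, 1)) D₂ + I (fun _ => 0) D₁ := by
      have h0 : I (fun _ => 0) D₁ = 0 := by simp [hI]
      rw [h0, add_zero, hI]
      simp only [inner_add_right]
      exact integral_add
        (integrable_inner_smul hpq hA hD₁ hF₁m (Eventually.of_forall fun x => hM₁ _))
        (integrable_inner_smul hpq hA hD₂ hF₂m (Eventually.of_forall fun x => hM₂ _))
    rw [hsum]
    refine Tendsto.add (Tendsto.add ?_ ?_) ?_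
    · refine tendsto_integral_inner_smul hpq hA hD₁ (fun _ => hD₁) hconst (M := M₁)
        (fun j => (hθm j).mul hF₁m)
        (fun j => Eventually.of_forall fun x => hbd (abs_cutoff_le_one j _) (hM₁ _)) ?_
      filter_upwards [hpos₁] with x hx
      simpa using (tendsto_cutoff hx).mul_const (fderiv ℝ F (v₁ x, v₂ x) (1, 0))
    · refine tendsto_integral_inner_smul hpq hA hD₂ (fun _ => hD₂) hconst (M := M₂)
        (fun j => (hθm j).mul hF₂m)
        (fun j => Eventually.of_forall fun x => hbd (abs_cutoff_le_one j _) (hM₂ _)) ?_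
      filter_upwards [hpos₁] with x hx
      simpa using (tendsto_cutoff hx).mul_const (fderiv ℝ F (v₁ x, v₂ x) (0, 1))
    · refine tendsto_integral_inner_smul hpq hA hD₁ (fun _ => hD₁) hconst (M := |C|)
        (fun j => hFm.mul (hθ'm j)) (fun j => ?_) ?_
      · filter_upwards [hpos₁, hpos₂] with x hx hy
        have h3 : F (v₁ x, v₂ x) ≤ |C| * v₁ x :=
          (hC _ _ hx hy).trans (mul_le_mul_of_nonneg_right (le_abs_self C) hx.le)
        calc |F (v₁ x, v₂ x) * cutoffDeriv j (v₁ x)|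
            = F (v₁ x, v₂ x) * |cutoffDeriv j (v₁ x)| := by
              rw [abs_mul, abs_of_nonneg (hF.nonneg _)]
          _ ≤ |C| * v₁ x * |cutoffDeriv j (v₁ x)| := by gcongr
          _ = |C| * |v₁ x * cutoffDeriv j (v₁ x)| := by
              rw [abs_mul, abs_of_pos hx, mul_assoc]
          _ ≤ |C| * 1 := by
              gcongr
              exact abs_mul_cutoffDeriv_le j _
          _ = |C| := mul_one _
      · filter_upwards [hpos₁] with x hx
        simpa using (tendsto_cutoffDeriv hx).const_mul (F (v₁ x, v₂ x))
  refine ⟨ge_of_tendsto' step3 fun j => ge_of_tendsto' (step2 j) (hL0 j), le_antisymm ?_ ?_⟩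
  · have hj (j : ℕ) : ∫⁻ x in Ω, ENNReal.ofReal (g x * (F (v₁ x, v₂ x) * cutoff j (v₁ x))) ≤
        ENNReal.ofReal (L' j) := by
      refine lintegral_ofReal_le_of_tendsto (fun n => (step1 j n).1.1) ?_
        (fun n => (step1' j n).le) (step2 j)
      filter_upwards [hφae] with x hx
      exact ((((contDiff_cutoff j).continuous.tendsto _).comp hx).const_mul _).const_mul _
    refine lintegral_ofReal_le_of_tendsto (fun j => hgm.mul (hFm.mul (hθm j))) ?_ hj step3
    filter_upwards [hpos₁] with x hx
    simpa using ((tendsto_cutoff hx).const_mul (F (v₁ x, v₂ x))).const_mul (g x)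
  · refine le_of_tendsto' ((ENNReal.continuous_ofReal.tendsto _).comp step3) fun j => ?_
    refine le_of_tendsto' ((ENNReal.continuous_ofReal.tendsto _).comp (step2 j)) fun n => ?_
    simp only [Function.comp]
    rw [← step1' j n]
    refine lintegral_mono_ae ?_
    filter_upwards [hg0] with x hx
    refine ENNReal.ofReal_le_ofReal (mul_le_mul_of_nonneg_left ?_ hx)
    exact mul_le_of_le_one_right (hF.nonneg _) (cutoff_le_one j _)

end Testing

/-! ### The comparison principle -/

lemma IsTestProfile.integrable_pairing {N : ℕ} {p : ℝ} (hp : 1 < p)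
    {Ω : Set (EuclideanSpace ℝ (Fin N))} {v₁ v₂ : EuclideanSpace ℝ (Fin N) → ℝ}
    {D₁ D₂ A : EuclideanSpace ℝ (Fin N) → EuclideanSpace ℝ (Fin N)}
    (h₁ : MemSobolev p Ω v₁ D₁) (h₂ : MemSobolev p Ω v₂ D₂)
    (hA : MemLp A (ENNReal.ofReal (Real.conjExponent p)) (volume.restrict Ω))
    {F : ℝ × ℝ → ℝ} (hF : IsTestProfile F) :
    Integrable (fun x => inner ℝ (A x) (fderiv ℝ F (v₁ x, v₂ x) (1, 0) • D₁ x
        + fderiv ℝ F (v₁ x, v₂ x) (0, 1) • D₂ x)) (volume.restrict Ω) := by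
  have hpq := Real.HolderConjugate.conjExponent hp
  obtain ⟨M₁, hM₁⟩ := hF.exists_fst_le
  obtain ⟨M₂, hM₂⟩ := hF.exists_snd_le
  have hF' : Continuous (fderiv ℝ F) := hF.contDiff.continuous_fderiv one_ne_zero
  have hvm : AEStronglyMeasurable (fun x => (v₁ x, v₂ x)) (volume.restrict Ω) :=
    h₁.memLp.1.prodMk h₂.memLp.1
  simp only [inner_add_right]
  exact (integrable_inner_smul hpq hA h₁.memLp_grad
      ((hF'.clm_apply continuous_const).comp_aestronglyMeasurable hvm)
      (Eventually.of_forall fun x => hM₁ _)).add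
    (integrable_inner_smul hpq hA h₂.memLp_grad
      ((hF'.clm_apply continuous_const).comp_aestronglyMeasurable hvm)
      (Eventually.of_forall fun x => hM₂ _))

lemma rpow_mul_relExcess_sq_mul_rpow {p s t : ℝ} (hs : 0 < s) :
    s ^ p * relExcess s t ^ 2 * s ^ (1 - p) = s * relExcess s t ^ 2 := by
  calc _ = s ^ p * s ^ (1 - p) * relExcess s t ^ 2 := by ring
    _ = _ := by rw [← Real.rpow_add hs]; simp

theorem theorem2p1 {N : ℕ} (p : ℝ) (hp : 1 < p) (hpN : p < (N : ℝ))
    (Ω : Set (EuclideanSpace ℝ (Fin N))) (hΩ : IsOpen Ω) (hΩb : Bornology.IsBounded Ω)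
    (G₁ G₂ : EuclideanSpace ℝ (Fin N) → ℝ → ℝ)
    (hG₁ : IsCaratheodory Ω G₁) (hG₂ : IsCaratheodory Ω G₂)
    (hG₁_nonneg : ∀ᵐ x ∂(volume.restrict Ω), ∀ s : ℝ, 0 < s → 0 ≤ G₁ x s)
    (hG₂_nonneg : ∀ᵐ x ∂(volume.restrict Ω), ∀ s : ℝ, 0 < s → 0 ≤ G₂ x s)
    (hdecr :
      (∀ᵐ x ∂(volume.restrict Ω), StrictAntiOn (fun s : ℝ => G₁ x s * s ^ (1 - p)) (Ioi 0)) ∨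
      (∀ᵐ x ∂(volume.restrict Ω), StrictAntiOn (fun s : ℝ => G₂ x s * s ^ (1 - p)) (Ioi 0)))
    (hle : ∀ᵐ x ∂(volume.restrict Ω), ∀ s : ℝ, 0 < s → G₁ x s ≤ G₂ x s)
    (v₁ v₂ : EuclideanSpace ℝ (Fin N) → ℝ)
    (hv₁ : IsWeakSolution p Ω G₁ v₁) (hv₂ : IsWeakSolution p Ω G₂ v₂) :
    ∀ᵐ x ∂(volume.restrict Ω), v₁ x ≤ v₂ x := by
  obtain ⟨D₁, hS₁, hpos₁, hloc₁, heq₁⟩ := hv₁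
  obtain ⟨D₂, hS₂, hpos₂, hloc₂, heq₂⟩ := hv₂
  have hp0 : 0 < p := by linarith
  set μ := volume.restrict Ω with hμ
  set k : ℕ → ℝ := fun n => (n : ℝ) + 1 with hk_def
  set ε : ℕ → ℝ := fun n => 1 / ((n : ℝ) + 1) with hε_def
  have hk0 (n : ℕ) : 0 < k n := by positivity
  have hε0 (n : ℕ) : 0 < ε n := by positivity
  have hk : Tendsto k atTop atTop :=
    tendsto_atTop_add_const_right _ _ tendsto_natCast_atTop_atTop
  have hε : Tendsto ε atTop (𝓝 0) := tendsto_one_div_add_atTop_nhds_zero_nat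
  have hA₁ := hS₁.memLp_grad.pFlux hp
  have hA₂ := hS₂.memLp_grad.pFlux hp
  have hg₁ : ∀ᵐ x ∂μ, 0 ≤ G₁ x (v₁ x) := by
    filter_upwards [hG₁_nonneg, hpos₁] with x h hx using h _ hx
  have hg₂ : ∀ᵐ x ∂μ, 0 ≤ G₂ x (v₂ x) := by
    filter_upwards [hG₂_nonneg, hpos₂] with x h hx using h _ hx
  have hF₁ (n : ℕ) := isTestProfile_profileFst hp (hk0 n) (hε0 n)
  have hF₂ (n : ℕ) := isTestProfile_profileSnd hp (hk0 n) (hε0 n)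
  have hvm : AEStronglyMeasurable (fun x => (v₁ x, v₂ x)) μ := hS₁.memLp.1.prodMk hS₂.memLp.1
  have hI₁ : Integrable (fun x => ‖D₁ x‖ ^ p) μ := by
    have := hS₁.memLp_grad.integrable_norm_rpow (by simpa using hp0) ENNReal.ofReal_ne_top
    rwa [ENNReal.toReal_ofReal hp0.le] at this
  have hI₂ : Integrable (fun x => ‖D₂ x‖ ^ p) μ := by
    have := hS₂.memLp_grad.integrable_norm_rpow (by simpa using hp0) ENNReal.ofReal_ne_top
    rwa [ENNReal.toReal_ofReal hp0.le] at this
  -- the energies of the two test functions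
  set L₁ : ℕ → ℝ := fun n => ∫ x in Ω, inner ℝ (pFlux p (D₁ x))
    (fderiv ℝ (profileFst p (k n) (ε n)) (v₁ x, v₂ x) (1, 0) • D₁ x
      + fderiv ℝ (profileFst p (k n) (ε n)) (v₁ x, v₂ x) (0, 1) • D₂ x) with hL₁
  set L₂ : ℕ → ℝ := fun n => ∫ x in Ω, inner ℝ (pFlux p (D₂ x))
    (fderiv ℝ (profileSnd p (k n) (ε n)) (v₁ x, v₂ x) (1, 0) • D₁ x
      + fderiv ℝ (profileSnd p (k n) (ε n)) (v₁ x, v₂ x) (0, 1) • D₂ x) with hL₂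
  have hT₁ (n : ℕ) : 0 ≤ L₁ n ∧
      ∫⁻ x in Ω, ENNReal.ofReal (G₁ x (v₁ x) * profileFst p (k n) (ε n) (v₁ x, v₂ x)) =
        ENNReal.ofReal (L₁ n) :=
    lintegral_ofReal_mul_profile hp hS₁ hS₂ hpos₁ hpos₂ hA₁ hloc₁ hg₁ heq₁ (hF₁ n)
  have hT₂ (n : ℕ) : 0 ≤ L₂ n ∧
      ∫⁻ x in Ω, ENNReal.ofReal (G₂ x (v₂ x) * profileSnd p (k n) (ε n) (v₁ x, v₂ x)) =
        ENNReal.ofReal (L₂ n) :=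
    lintegral_ofReal_mul_profile hp hS₁ hS₂ hpos₁ hpos₂ hA₂ hloc₂ hg₂ heq₂ (hF₂ n)
  -- the truncation error in the Picone-type inequality
  set δ : ℕ → ℝ := fun n =>
    ∫ x in Ω, (p - 1) * ((v₁ x + ε n) / (k n + (v₁ x + ε n))) * ‖D₁ x‖ ^ p with hδ_def
  have hδm (n : ℕ) : AEStronglyMeasurable
      (fun x => (p - 1) * ((v₁ x + ε n) / (k n + (v₁ x + ε n))) * ‖D₁ x‖ ^ p) μ := by
    have hv := hS₁.memLp.1.aemeasurable
    exact ((((hv.add_const _).div ((hv.add_const _).const_add _)).const_mul _).mul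
      hI₁.1.aemeasurable).aestronglyMeasurable
  have hδb (n : ℕ) : ∀ᵐ x ∂μ,
      ‖(p - 1) * ((v₁ x + ε n) / (k n + (v₁ x + ε n))) * ‖D₁ x‖ ^ p‖ ≤
        (p - 1) * ‖D₁ x‖ ^ p := by
    filter_upwards [hpos₁] with x hx
    have h1 := hk0 n
    have h2 := hε0 n
    have h3 : 0 ≤ ‖D₁ x‖ ^ p := Real.rpow_nonneg (norm_nonneg _) _
    have h4 : (v₁ x + ε n) / (k n + (v₁ x + ε n)) ≤ 1 := (div_le_one (by positivity)).2 (by linarith)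
    have h5 : 0 ≤ p - 1 := by linarith
    rw [Real.norm_of_nonneg (by positivity)]
    calc _ ≤ (p - 1) * 1 * ‖D₁ x‖ ^ p := by gcongr
      _ = _ := by ring
  have hδi (n : ℕ) : Integrable
      (fun x => (p - 1) * ((v₁ x + ε n) / (k n + (v₁ x + ε n))) * ‖D₁ x‖ ^ p) μ :=
    (hI₁.const_mul (p - 1)).mono' (hδm n) (hδb n)
  have hδ : Tendsto δ atTop (𝓝 0) := by
    have h := tendsto_integral_of_dominated_convergence (μ := μ) (f := fun _ => (0 : ℝ))
      (fun x => (p - 1) * ‖D₁ x‖ ^ p) hδm (hI₁.const_mul (p - 1)) hδb ?_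
    · simpa using h
    · refine Eventually.of_forall fun x => ?_
      have h1 : Tendsto (fun n => (v₁ x + ε n) / (k n + (v₁ x + ε n))) atTop (𝓝 0) := by
        have hx : Tendsto (fun n => v₁ x + ε n) atTop (𝓝 (v₁ x + 0)) := hε.const_add _
        exact hx.div_atTop (hk.atTop_add hx)
      simpa using (h1.const_mul (p - 1)).mul_const (‖D₁ x‖ ^ p)
  have hL₂₁ (n : ℕ) : L₂ n ≤ L₁ n + δ n := by
    have i₁ := (hF₁ n).integrable_pairing hp hS₁.toMemSobolev hS₂.toMemSobolev hA₁
    have i₂ := (hF₂ n).integrable_pairing hp hS₁.toMemSobolev hS₂.toMemSobolev hA₂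
    rw [hL₂, hL₁, hδ_def]
    simp only
    rw [← integral_add i₁ (hδi n)]
    refine integral_mono_ae i₂ (i₁.add (hδi n)) ?_
    filter_upwards [hpos₁, hpos₂] with x hx hy
    have := picone_profile hp (hk0 n) (hε0 n) hx hy (D₁ x) (D₂ x)
    linarith
  have hL₁B (n : ℕ) : L₁ n ≤ ∫ x in Ω, (2 * p + 2) *
      (‖D₁ x‖ ^ p + ((1 - 1 / p) * ‖D₁ x‖ ^ p + 1 / p * ‖D₂ x‖ ^ p)) := by
    refine integral_mono_ae
      ((hF₁ n).integrable_pairing hp hS₁.toMemSobolev hS₂.toMemSobolev hA₁)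
      ((hI₁.add ((hI₁.const_mul _).add (hI₂.const_mul _))).const_mul _)
      (Eventually.of_forall fun x => ?_)
    simp only
    rw [inner_add_right, real_inner_smul_right, real_inner_smul_right, inner_pFlux_self hp, mul_add]
    have h1 := abs_fderiv_profileFst_fst_le hp (hk0 n) (hε0 n) (v₁ x, v₂ x)
    have h2 := abs_fderiv_profileFst_snd_le hp (hk0 n) (hε0 n) (v₁ x, v₂ x)
    have h3 := abs_inner_pFlux_le hp (D₁ x) (D₂ x)
    refine add_le_add ?_ ((le_abs_self _).trans ?_)
    · exact mul_le_mul_of_nonneg_right ((le_abs_self _).trans h1)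
        (Real.rpow_nonneg (norm_nonneg _) _)
    · rw [abs_mul]
      exact mul_le_mul h2 h3 (abs_nonneg _) (by linarith)
  -- the limits of the right hand sides
  set f₁ : EuclideanSpace ℝ (Fin N) → ℝ := fun x =>
    G₁ x (v₁ x) * (v₁ x ^ p * relExcess (v₁ x) (v₂ x) ^ 2 * v₁ x ^ (1 - p)) with hf₁
  set f₂ : EuclideanSpace ℝ (Fin N) → ℝ := fun x =>
    G₂ x (v₂ x) * (v₁ x ^ p * relExcess (v₁ x) (v₂ x) ^ 2 * v₂ x ^ (1 - p)) with hf₂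
  have hlim₁ : ∀ᵐ x ∂μ, Tendsto (fun n => G₁ x (v₁ x) * profileFst p (k n) (ε n) (v₁ x, v₂ x))
      atTop (𝓝 (f₁ x)) := by
    filter_upwards [hpos₁, hpos₂] with x hx hy
    exact (tendsto_profileFst hk hε0 hε hp0 hx hy).const_mul _
  have hlim₂ : ∀ᵐ x ∂μ, Tendsto (fun n => G₂ x (v₂ x) * profileSnd p (k n) (ε n) (v₁ x, v₂ x))
      atTop (𝓝 (f₂ x)) := by
    filter_upwards [hpos₁, hpos₂] with x hx hy
    exact (tendsto_profileSnd hk hε0 hε hp0 hx hy).const_mul _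
  have hm₁ (n : ℕ) : AEStronglyMeasurable
      (fun x => G₁ x (v₁ x) * profileFst p (k n) (ε n) (v₁ x, v₂ x)) μ :=
    hloc₁.aestronglyMeasurable.mul ((hF₁ n).contDiff.continuous.comp_aestronglyMeasurable hvm)
  have hm₂ (n : ℕ) : AEStronglyMeasurable
      (fun x => G₂ x (v₂ x) * profileSnd p (k n) (ε n) (v₁ x, v₂ x)) μ :=
    hloc₂.aestronglyMeasurable.mul ((hF₂ n).contDiff.continuous.comp_aestronglyMeasurable hvm)
  have hfin : ∫⁻ x, ENNReal.ofReal (f₁ x) ∂μ ≠ ⊤ :=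
    ne_top_of_le_ne_top ENNReal.ofReal_ne_top (lintegral_ofReal_le_of_tendsto hm₁ hlim₁
      (fun n => (hT₁ n).2.le.trans (ENNReal.ofReal_le_ofReal (hL₁B n))) tendsto_const_nhds)
  -- `profileFst` lies below its limit
  have hL₁a (n : ℕ) : L₁ n ≤ (∫⁻ x, ENNReal.ofReal (f₁ x) ∂μ).toReal := by
    rw [← ENNReal.ofReal_le_iff_le_toReal hfin, ← (hT₁ n).2]
    refine lintegral_mono_ae ?_
    filter_upwards [hpos₁, hpos₂, hg₁] with x hx hy h0
    refine ENNReal.ofReal_le_ofReal (mul_le_mul_of_nonneg_left ?_ h0)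
    rw [rpow_mul_relExcess_sq_mul_rpow hx]
    exact profileFst_le hp (hk0 n) (hε0 n) hx hy
  have hba : ∫⁻ x, ENNReal.ofReal (f₂ x) ∂μ ≤ ∫⁻ x, ENNReal.ofReal (f₁ x) ∂μ := by
    rw [← ENNReal.ofReal_toReal hfin]
    refine lintegral_ofReal_le_of_tendsto hm₂ hlim₂
      (l := fun n => (∫⁻ x, ENNReal.ofReal (f₁ x) ∂μ).toReal + δ n) (fun n => ?_) ?_
    · rw [(hT₂ n).2]
      exact ENNReal.ofReal_le_ofReal ((hL₂₁ n).trans (by linarith [hL₁a n]))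
    · simpa using hδ.const_add _
  -- the opposite inequality holds pointwise, and strictly where `v₁ > v₂`
  have hstrict : ∀ᵐ x ∂μ, v₂ x < v₁ x →
      G₁ x (v₁ x) * v₁ x ^ (1 - p) < G₂ x (v₂ x) * v₂ x ^ (1 - p) := by
    rcases hdecr with h | h
    · filter_upwards [h, hle, hpos₁, hpos₂] with x hx hle h1 h2 hlt
      exact (hx h2 h1 hlt).trans_le
        (mul_le_mul_of_nonneg_right (hle _ h2) (Real.rpow_nonneg h2.le _))
    · filter_upwards [h, hle, hpos₁, hpos₂] with x hx hle h1 h2 hlt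
      exact (mul_le_mul_of_nonneg_right (hle _ h1) (Real.rpow_nonneg h1.le _)).trans_lt
        (hx h2 h1 hlt)
  have hlt : ∀ᵐ x ∂μ, v₂ x < v₁ x → ENNReal.ofReal (f₁ x) < ENNReal.ofReal (f₂ x) := by
    filter_upwards [hstrict, hpos₁, hpos₂, hg₁] with x hx h1 h2 h0 h
    have hw : 0 < relExcess (v₁ x) (v₂ x) :=
      lt_max_of_lt_left (sub_pos.2 ((div_lt_one h1).2 h))
    have hm : 0 < v₁ x ^ p * relExcess (v₁ x) (v₂ x) ^ 2 :=
      mul_pos (Real.rpow_pos_of_pos h1 _) (pow_pos hw 2)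
    have e₁ : f₁ x = v₁ x ^ p * relExcess (v₁ x) (v₂ x) ^ 2 * (G₁ x (v₁ x) * v₁ x ^ (1 - p)) := by
      rw [hf₁]; ring
    have e₂ : f₂ x = v₁ x ^ p * relExcess (v₁ x) (v₂ x) ^ 2 * (G₂ x (v₂ x) * v₂ x ^ (1 - p)) := by
      rw [hf₂]; ring
    have h3 : f₁ x < f₂ x := by
      rw [e₁, e₂]; exact mul_lt_mul_of_pos_left (hx h) hm
    have h4 : 0 ≤ f₁ x := by
      rw [e₁]; exact mul_nonneg hm.le (mul_nonneg h0 (Real.rpow_nonneg h1.le _))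
    exact (ENNReal.ofReal_lt_ofReal_iff (h4.trans_lt h3)).2 h3
  have hle' : (fun x => ENNReal.ofReal (f₁ x)) ≤ᵐ[μ] fun x => ENNReal.ofReal (f₂ x) := by
    filter_upwards [hlt, hpos₁] with x hx h1
    rcases lt_or_ge (v₂ x) (v₁ x) with h | h
    · exact (hx h).le
    · have hw : relExcess (v₁ x) (v₂ x) = 0 :=
        max_eq_right (sub_nonpos.2 ((one_le_div h1).2 h))
      simp [hf₁, hf₂, hw]
  have hf₂m : AEMeasurable (fun x => ENNReal.ofReal (f₂ x)) μ :=
    (aemeasurable_of_tendsto_metrizable_ae' (fun n => (hm₂ n).aemeasurable) hlim₂).ennreal_ofReal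
  filter_upwards [ae_eq_of_ae_le_of_lintegral_le hle' hfin hf₂m hba, hlt] with x hx h
  by_contra! hcon
  exact (h hcon).ne hx
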